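/- **Setting.** For $n\in\mathbb N$ let $\mathcal H_n$ be the Haar distribution on $n$-qubit pure states (the uniform probability measure on the unit sphere of $\mathbb C^{2^n}$), and let $\mathsf{TD}(\rho,\sigma)=\tfrac12\|\rho-\sigma\|_1$ be the trace distance. Let $n:\mathbb N\to\mathbb N$ (number of qubits of the common Haar state) and $\ell:\mathbb N\to\mathbb N$ (number of copies). A family of maps $G=\{G_k\}$, where for each $\lambda\in\mathbb N$ and $k\in\{0,1\}^\lambda$ the map $G_k$ acts on operators of $n(\lambda)$ qubits, is a *multi-key statistically secure $(\lambda,n,\ell)$-PRS generator in the common Haar state (CHS) model* if 1. $G$ is quantum polynomial time: some polynomial-time Turing machine, on input $1^\lambda$, prints a quantum circuit (over a fixed finite universal gate set, with ancillas initialised to $|0\rangle$) which on input $|k\rangle\langle k|\otimes\rho$ outputs $G_k(\rho)$ in its state register; 2. every $G_k$ is a quantum channel that maps each pure state $|\vartheta\rangle\langle\vartheta|$ to a pure state $|\vartheta_k\rangle\langle\vartheta_k|$; 3. for all polynomially bounded $t,p:\mathbb N\to\mathbb N$ and every non-uniform, unbounded adversary $A=\{A_\lambda\}$ (for each $\lambda$,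 an arbitrary two-outcome measurement) there is a negligible function $\mathsf{negl}$ with, for all $\lambda$ and with $n,\ell,t,p$ evaluated at $\lambda$, $$\Bigl|\Pr_{k_1,\dots,k_p\leftarrow\{0,1\}^\lambda,\ \vartheta\leftarrow\mathcal H_{n}}\Bigl[A_\lambda\Bigl(\bigotimes_{i=1}^{p}G_{k_i}(|\vartheta\rangle\langle\vartheta|)^{\otimes\ell}\otimes|\vartheta\rangle\langle\vartheta|^{\otimes t}\Bigr)=1\Bigr]-\Pr_{\varphi_1,\dots,\varphi_p,\vartheta\leftarrow\mathcal H_{n}}\Bigl[A_\lambda\Bigl(\bigotimes_{i=1}^{p}|\varphi_i\rangle\langle\varphi_i|^{\otimes\ell}\otimes|\vartheta\rangle\langle\vartheta|^{\otimes t}\Bigr)=1\Bigr]\Bigr|\le\mathsf{negl}(\lambda).$$ **Construction.** For $\lambda\le n$ and $k\in\{0,1\}^\lambda$ let $G_k(|\vartheta\rangle)=(Z^k\otimes I_{n-\lambda})|\vartheta\rangle$, where $Z^k=Z^{k_1}\otimes\cdots\otimes Z^{k_\lambda}$; that is, $G_k(\rho)=(Z^k\otimes I_{n-\lambda})\,\rho\,(Z^k\otimes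 I_{n-\lambda})^\dagger$. **Theorem.** (a) Let $n(\lambda)\ge\lambda$ for all $\lambda$, let $\varepsilon>0$ be a constant, and let $\ell(\lambda)=O\bigl(\lambda/\log(\lambda)^{1+\varepsilon}\bigr)$. Then $G$ is a multi-key statistically secure $(\lambda,n,\ell)$-PRS generator in the CHS model; in particular such a generator exists. (b) There is an absolute constant $c$ such that for all natural numbers $\lambda,n,\ell,t$ with $\lambda\le n$, $$\mathsf{TD}\Bigl(\mathop{\mathbb E}_{k\leftarrow\{0,1\}^\lambda,\ \vartheta\leftarrow\mathcal H_n}\bigl[G_k(|\vartheta\rangle\langle\vartheta|)^{\otimes\ell}\otimes|\vartheta\rangle\langle\vartheta|^{\otimes t}\bigr],\ \mathop{\mathbb E}_{\varphi,\vartheta\leftarrow\mathcal H_n}\bigl[|\varphi\rangle\langle\varphi|^{\otimes\ell}\otimes|\vartheta\rangle\langle\vartheta|^{\otimes t}\bigr]\Bigr)\le c\,\frac{(\ell+t)^{2\ell}}{2^\lambda}.$$ (c) There is an absolute constant $c$ such that for all natural numbers $\lambda,n,\ell,t,p$ with $\lambda\le n$, $$\mathsf{TD}\Bigl(\mathop{\mathbb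 E}_{k_1,\dots,k_p\leftarrow\{0,1\}^\lambda,\ \vartheta\leftarrow\mathcal H_n}\Bigl[\bigotimes_{i=1}^pG_{k_i}(|\vartheta\rangle\langle\vartheta|)^{\otimes\ell}\otimes|\vartheta\rangle\langle\vartheta|^{\otimes t}\Bigr],\ \mathop{\mathbb E}_{\varphi_1,\dots,\varphi_p,\vartheta\leftarrow\mathcal H_n}\Bigl[\bigotimes_{i=1}^p|\varphi_i\rangle\langle\varphi_i|^{\otimes\ell}\otimes|\vartheta\rangle\langle\vartheta|^{\otimes t}\Bigr]\Bigr)\le c\,\frac{p\,(p\ell+t)^{2\ell}}{2^\lambda}.$$ Here $0^0=1$, and the $\varphi$'s, $\vartheta$ and the keys are independent. -/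

import Mathlib

noncomputable section

namespace CHS

open scoped BigOperators Matrix Kronecker ComplexOrder

/-! ### Qubits, operators and tensor powers -/

/-- Computational basis labels of `n` qubits, i.e. bit strings of length `n`. -/
abbrev Bits (n : ℕ) : Type := Fin n → Bool

/-- Operators on the Hilbert space with orthonormal basis `ι`. -/
abbrev Op (ι : Type) : Type := Matrix ι ι ℂ

/-- The tensor product `⨂ i, A i` of a finite family of operators. -/
def tensorPi {κ ι : Type} [Fintype κ] (A : κ → Op ι) : Op (κ → ι) :=
  Matrix.of fun x y => ∏ i, A i (x i) (y i)

/-- The tensor power `A ^ ⊗ m`. -/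
def tensorPow {ι : Type} (A : Op ι) (m : ℕ) : Op (Fin m → ι) :=
  tensorPi fun _ : Fin m => A

/-- The trace norm `‖X‖₁ = Tr √(Xᴴ X)`: the sum of the square roots of the eigenvalues of
`Xᴴ X`, with multiplicity. -/
def traceNorm {ι : Type} [Fintype ι] [DecidableEq ι] (X : Op ι) : ℝ :=
  ∑ i, √((Matrix.isHermitian_conjTranspose_mul_self X).eigenvalues i)

/-- The trace distance `‖ρ - σ‖₁ / 2`. -/
def traceDist {ι : Type} [Fintype ι] [DecidableEq ι] (ρ σ : Op ι) : ℝ :=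
  traceNorm (ρ - σ) / 2

/-! ### Haar random states -/

/-- Unit vectors of the `n`-qubit Hilbert space. -/
abbrev PureState (n : ℕ) : Type := Metric.sphere (0 : EuclideanSpace ℂ (Bits n)) 1

/-- The rank one projection `|ψ⟩⟨ψ|`. -/
def PureState.density {n : ℕ} (ψ : PureState n) : Op (Bits n) :=
  Matrix.of fun x y => ψ.1 x * star (ψ.1 y)

/-- The Haar distribution on `n`-qubit pure states: the uniform (rotation invariant)
probability measure on the unit sphere. -/
def haarState (n : ℕ) : MeasureTheory.Measure (PureState n) :=
  ((MeasureTheory.volume : MeasureTheory.Measure (EuclideanSpace ℂ (Bits n))).toSphere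
      Set.univ)⁻¹ •
    (MeasureTheory.volume : MeasureTheory.Measure (EuclideanSpace ℂ (Bits n))).toSphere

instance (n : ℕ) : MeasureTheory.IsProbabilityMeasure (haarState n) := by
  constructor
  have h0 : (MeasureTheory.volume :
      MeasureTheory.Measure (EuclideanSpace ℂ (Bits n))).toSphere Set.univ ≠ 0 := by
    rw [Ne, MeasureTheory.Measure.measure_univ_eq_zero]
    exact MeasureTheory.Measure.toSphere_ne_zero _
  rw [haarState, MeasureTheory.Measure.smul_apply, smul_eq_mul]
  exact ENNReal.inv_mul_cancel h0 (MeasureTheory.measure_ne_top _ _)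

/-! ### Quantum circuits and efficient generators -/

/-- The three registers of a generation circuit: the key, the common Haar state (which is also
the output register), and ancillas. -/
inductive Reg
  | key | st | anc
  deriving DecidableEq

/-- The name of a wire: a register and a position in it. -/
structure Loc where
  reg : Reg
  idx : ℕ

/-- Gates over the universal gate set Hadamard, T, controlled NOT, controlled Z. -/
inductive Gate
  | had (w : Loc)
  | tee (w : Loc)
  | cnot (c w : Loc)
  | cz (c w : Loc)

/-- A circuit is the list of its gates; the head of the list is applied first. -/
abbrev Circuit : Type := List Gate

/-- The alphabet in which circuits are written down. -/
inductive Sym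
  | had | tee | cnot | cz | key | st | anc | tick | sep
  deriving DecidableEq

def Reg.sym : Reg → Sym
  | .key => .key
  | .st => .st
  | .anc => .anc

/-- A wire name is written as its register, its position in unary, and a separator. -/
def Loc.encode (w : Loc) : List Sym :=
  w.reg.sym :: (List.replicate w.idx Sym.tick ++ [Sym.sep])

def Gate.encode : Gate → List Sym
  | .had w => Sym.had :: w.encode
  | .tee w => Sym.tee :: w.encode
  | .cnot c w => Sym.cnot :: (c.encode ++ w.encode)
  | .cz c w => Sym.cz :: (c.encode ++ w.encode)

/-- The description of a circuit. -/
def encodeCircuit (C : Circuit) : List Sym := C.flatMap Gate.encode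

theorem Loc.encode_append_inj {v w : Loc} {l l' : List Sym}
    (h : v.encode ++ l = w.encode ++ l') : v = w ∧ l = l' := by
  obtain ⟨r, i⟩ := v
  obtain ⟨s, j⟩ := w
  simp only [Loc.encode, List.cons_append, List.append_assoc, List.cons.injEq,
    List.nil_append] at h
  obtain ⟨hr, h⟩ := h
  have hrs : r = s := by cases r <;> cases s <;> simp_all [Reg.sym]
  subst hrs
  have key : ∀ (i j : ℕ), List.replicate i Sym.tick ++ (Sym.sep :: l) =
      List.replicate j Sym.tick ++ (Sym.sep :: l') → i = j ∧ l = l' := by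
    intro i
    induction i with
    | zero =>
      intro j hj
      cases j with
      | zero => simpa using hj
      | succ j => simp [List.replicate_succ] at hj
    | succ i ih =>
      intro j hj
      cases j with
      | zero => simp [List.replicate_succ] at hj
      | succ j =>
        simp only [List.replicate_succ, List.cons_append, List.cons.injEq, true_and] at hj
        obtain ⟨h1, h2⟩ := ih j hj
        exact ⟨by rw [h1], h2⟩
  obtain ⟨h1, h2⟩ := key i j h
  exact ⟨by rw [h1], h2⟩

/-- Circuits can be recovered from their descriptions. -/
theorem encodeCircuit_injective : Function.Injective encodeCircuit := by
  intro C
  induction C with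
  | nil =>
    intro D h
    cases D with
    | nil => rfl
    | cons g D => cases g <;> simp [encodeCircuit, Gate.encode] at h
  | cons f C ih =>
    intro D h
    cases D with
    | nil => cases f <;> simp [encodeCircuit, Gate.encode] at h
    | cons g D =>
      have hC : ∀ (g : Gate) (C : Circuit),
          encodeCircuit (g :: C) = g.encode ++ encodeCircuit C := fun g C => by
        simp [encodeCircuit]
      rw [hC, hC] at h
      cases f <;> cases g <;>
        simp only [Gate.encode, List.cons_append, List.append_assoc, List.cons.injEq,
          reduceCtorEq, false_and, true_and] at h
      all_goals
        obtain ⟨h1, h⟩ := Loc.encode_append_inj h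
        first
          | (rw [h1, ih h])
          | (obtain ⟨h2, h⟩ := Loc.encode_append_inj h
             rw [h1, h2, ih h])

/-- The wires of a circuit with `lam` key qubits, `n` state qubits and `a` ancillas. -/
abbrev Wire (lam n a : ℕ) : Type := Fin lam ⊕ Fin n ⊕ Fin a

/-- The wire with a given name, if there is one. -/
def Loc.wire (lam n a : ℕ) (w : Loc) : Option (Wire lam n a) :=
  match w.reg with
  | .key => if h : w.idx < lam then some (Sum.inl ⟨w.idx, h⟩) else none
  | .st => if h : w.idx < n then some (Sum.inr (Sum.inl ⟨w.idx, h⟩)) else none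
  | .anc => if h : w.idx < a then some (Sum.inr (Sum.inr ⟨w.idx, h⟩)) else none

section Gates

variable {W : Type} [Fintype W] [DecidableEq W]

/-- The one-qubit operator `u` on wire `w`, and the identity on all other wires. -/
def onWire (u : Op Bool) (w : W) : Op (W → Bool) :=
  Matrix.of fun x y => if ∀ v, v ≠ w → x v = y v then u (x w) (y w) else 0

def hadamard : Op Bool :=
  Matrix.of fun a b => (if a && b then -1 else 1) / (√2 : ℝ)

def tGate : Op Bool :=
  Matrix.diagonal fun b => if b then Complex.exp (Real.pi * Complex.I / 4) else 1

/-- Controlled NOT: `|y⟩ ↦ |y with bit w replaced by y w xor y c⟩`. -/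
def cnotOp (c w : W) : Op (W → Bool) :=
  Matrix.of fun x y => if x = Function.update y w (xor (y w) (y c)) then 1 else 0

/-- Controlled Z. -/
def czOp (c w : W) : Op (W → Bool) :=
  Matrix.diagonal fun x => if x c && x w then -1 else 1

end Gates

/-- The unitary of a gate. A gate that names a wire which does not exist, and a two-qubit gate
whose two wires coincide, are skipped. -/
def Gate.op (lam n a : ℕ) : Gate → Op (Wire lam n a → Bool)
  | .had w => match w.wire lam n a with
    | some v => onWire hadamard v
    | none => 1
  | .tee w => match w.wire lam n a with
    | some v => onWire tGate v
    | none => 1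
  | .cnot c w => match c.wire lam n a, w.wire lam n a with
    | some u, some v => if u = v then 1 else cnotOp u v
    | _, _ => 1
  | .cz c w => match c.wire lam n a, w.wire lam n a with
    | some u, some v => if u = v then 1 else czOp u v
    | _, _ => 1

/-- The unitary of a circuit. -/
def Circuit.op (lam n a : ℕ) (C : Circuit) : Op (Wire lam n a → Bool) :=
  C.foldl (fun U g => g.op lam n a * U) 1

def Gate.locs : Gate → List Loc
  | .had w => [w]
  | .tee w => [w]
  | .cnot c w => [c, w]
  | .cz c w => [c, w]

/-- The number of ancillas of a circuit: one more than the largest ancilla position it names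
(zero if it names none). -/
def Circuit.ancillas (C : Circuit) : ℕ :=
  (C.flatMap Gate.locs).foldr
    (fun w m => match w.reg with
      | .anc => max (w.idx + 1) m
      | _ => m) 0

/-- The basis label of all wires assembled from those of the three registers. -/
def joinBits {lam n a : ℕ} (k : Bits lam) (x : Bits n) (z : Bits a) : Wire lam n a → Bool :=
  Sum.elim k (Sum.elim x z)

/-- The operator `|k⟩⟨k| ⊗ ρ ⊗ |0⟩⟨0|` on all wires. -/
def inputOp {lam n : ℕ} (a : ℕ) (k : Bits lam) (ρ : Op (Bits n)) :
    Op (Wire lam n a → Bool) :=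
  Matrix.of fun x y =>
    if ((fun i => x (Sum.inl i)) = k ∧ ∀ i, x (Sum.inr (Sum.inr i)) = false) ∧
        ((fun i => y (Sum.inl i)) = k ∧ ∀ i, y (Sum.inr (Sum.inr i)) = false) then
      ρ (fun i => x (Sum.inr (Sum.inl i))) (fun i => y (Sum.inr (Sum.inl i)))
    else 0

/-- The partial trace over the key register and the ancillas. -/
def traceOut {lam n a : ℕ} (X : Op (Wire lam n a → Bool)) : Op (Bits n) :=
  Matrix.of fun x y => ∑ k : Bits lam, ∑ z : Bits a, X (joinBits k x z) (joinBits k y z)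

/-- Run a circuit with `a` ancillas on key `k` and input `ρ`. -/
def runWith {lam n : ℕ} (a : ℕ) (C : Circuit) (k : Bits lam) (ρ : Op (Bits n)) : Op (Bits n) :=
  traceOut (C.op lam n a * inputOp a k ρ * (C.op lam n a)ᴴ)

/-- Run a circuit on key `k` and input `ρ`. -/
def Circuit.run {lam n : ℕ} (C : Circuit) (k : Bits lam) (ρ : Op (Bits n)) : Op (Bits n) :=
  runWith C.ancillas C k ρ

/-- A generator: for every security parameter `lam` and every key in `{0,1}^lam`, a map on
operators of `n lam` qubits. -/
abbrev Generator (n : ℕ → ℕ) : Type :=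
  ∀ lam : ℕ, Bits lam → Op (Bits (n lam)) → Op (Bits (n lam))

/-- Quantum polynomial time: some classical Turing machine prints, on input `1^lam` and in time
polynomial in `lam`, a quantum circuit that implements the generator. -/
def IsQPT {n : ℕ → ℕ} (G : Generator n) : Prop :=
  ∃ C : ℕ → Circuit,
    Nonempty (Turing.TM2ComputableInPolyTime Computability.unaryEncodeNat encodeCircuit C) ∧
    ∀ lam k ρ, G lam k ρ = (C lam).run k ρ

/-- Quantum channels (completely positive trace preserving maps), in Kraus form. -/
def IsChannel {ι : Type} [Fintype ι] [DecidableEq ι] (Φ : Op ι → Op ι) : Prop :=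
  ∃ (r : ℕ) (K : Fin r → Op ι), ∑ i, (K i)ᴴ * K i = 1 ∧ ∀ ρ, Φ ρ = ∑ i, K i * ρ * (K i)ᴴ

/-! ### Pseudorandom state generators in the common Haar state model -/

section Security

variable {lam n : ℕ}

/-- `E_{k, ϑ} [ G_k(|ϑ⟩⟨ϑ|)^{⊗ ℓ} ⊗ |ϑ⟩⟨ϑ|^{⊗ t} ]`. -/
def realState (G : Bits lam → Op (Bits n) → Op (Bits n)) (ℓ t : ℕ) :
    Op ((Fin ℓ → Bits n) × (Fin t → Bits n)) :=
  Matrix.of fun x y => 𝔼 k : Bits lam, ∫ ϑ : PureState n,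
    (tensorPow (G k ϑ.density) ℓ ⊗ₖ tensorPow ϑ.density t) x y ∂haarState n

/-- `E_{φ, ϑ} [ |φ⟩⟨φ|^{⊗ ℓ} ⊗ |ϑ⟩⟨ϑ|^{⊗ t} ]`. -/
def idealState (n ℓ t : ℕ) : Op ((Fin ℓ → Bits n) × (Fin t → Bits n)) :=
  Matrix.of fun x y => ∫ ω : PureState n × PureState n,
    (tensorPow ω.1.density ℓ ⊗ₖ tensorPow ω.2.density t) x y
      ∂((haarState n).prod (haarState n))

/-- `E_{k_1, …, k_p, ϑ} [ (⨂ i, G_{k_i}(|ϑ⟩⟨ϑ|)^{⊗ ℓ}) ⊗ |ϑ⟩⟨ϑ|^{⊗ t} ]`. -/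
def realStateMulti (G : Bits lam → Op (Bits n) → Op (Bits n)) (ℓ t p : ℕ) :
    Op ((Fin p → Fin ℓ → Bits n) × (Fin t → Bits n)) :=
  Matrix.of fun x y => 𝔼 k : Fin p → Bits lam, ∫ ϑ : PureState n,
    (tensorPi (fun i => tensorPow (G (k i) ϑ.density) ℓ) ⊗ₖ tensorPow ϑ.density t) x y
      ∂haarState n

/-- `E_{φ_1, …, φ_p, ϑ} [ (⨂ i, |φ_i⟩⟨φ_i|^{⊗ ℓ}) ⊗ |ϑ⟩⟨ϑ|^{⊗ t} ]`. -/
def idealStateMulti (n ℓ t p : ℕ) : Op ((Fin p → Fin ℓ → Bits n) × (Fin t → Bits n)) :=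
  Matrix.of fun x y => ∫ ω : (Fin p → PureState n) × PureState n,
    (tensorPi (fun i => tensorPow (ω.1 i).density ℓ) ⊗ₖ tensorPow ω.2.density t) x y
      ∂((MeasureTheory.Measure.pi fun _ : Fin p => haarState n).prod (haarState n))

end Security

/-- The `accept` element `M` of a measurement `{M, 1 - M}`: an arbitrary (unbounded)
distinguisher with one bit of output. -/
structure Test (ι : Type) [Fintype ι] [DecidableEq ι] where
  M : Op ι
  pos : M.PosSemidef
  le_one : (1 - M).PosSemidef

/-- The probability that the test outputs `1` on the state `ρ`. -/
def Test.prob {ι : Type} [Fintype ι] [DecidableEq ι] (A : Test ι) (ρ : Op ι) : ℝ :=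
  (A.M * ρ).trace.re

def PolyBounded (f : ℕ → ℕ) : Prop := ∃ q : Polynomial ℕ, ∀ m, f m ≤ q.eval m

def Negligible (f : ℕ → ℝ) : Prop :=
  Asymptotics.SuperpolynomialDecay Filter.atTop (fun m : ℕ => (m : ℝ)) f

/-- Multi-key statistically secure `(lam, n, ℓ)`-pseudorandom state generators in the common
Haar state model. -/
structure IsMultiKeyPRSG (n ℓ : ℕ → ℕ) (G : Generator n) : Prop where
  qpt : IsQPT G
  channel : ∀ lam k, IsChannel (G lam k)
  stateGeneration : ∀ lam k (ϑ : PureState (n lam)), ∃ ϑ' : PureState (n lam),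
    G lam k ϑ.density = ϑ'.density
  pseudorandomness : ∀ t p : ℕ → ℕ, PolyBounded t → PolyBounded p →
    ∀ A : ∀ lam : ℕ,
      Test ((Fin (p lam) → Fin (ℓ lam) → Bits (n lam)) × (Fin (t lam) → Bits (n lam))),
    ∃ negl : ℕ → ℝ, Negligible negl ∧ ∀ lam,
      |(A lam).prob (realStateMulti (G lam) (ℓ lam) (t lam) (p lam)) -
        (A lam).prob (idealStateMulti (n lam) (ℓ lam) (t lam) (p lam))| ≤ negl lam

/-! ### The construction -/

/-- The Pauli operator `Z = diag(1, -1)`. -/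
def pauliZ : Op Bool := Matrix.diagonal fun b => if b then -1 else 1

/-- For `lam ≤ n`, the operator `Z^k ⊗ I_{n - lam}` on `n` qubits, where
`Z^k = Z^{k_1} ⊗ ⋯ ⊗ Z^{k_lam}` acts on the first `lam` qubits. -/
def phaseOp {lam : ℕ} (n : ℕ) (k : Bits lam) : Op (Bits n) :=
  tensorPi fun j : Fin n => if h : j.1 < lam then pauliZ ^ (k ⟨j.1, h⟩).toNat else 1

/-- The channel `|ϑ⟩ ↦ (Z^k ⊗ I_{n - lam}) |ϑ⟩`. -/
def phaseMap {lam : ℕ} (n : ℕ) (k : Bits lam) (ρ : Op (Bits n)) : Op (Bits n) :=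
  phaseOp n k * ρ * (phaseOp n k)ᴴ

end CHS

end

/-! The Haar measure is unitarily invariant. Invariance under phases shows that the entries of
`E |ϑ⟩⟨ϑ|^{⊗ m}` vanish except between permutations of the same tuple; basis permutations and
rotations of two coordinates show that its entry at a tuple of `m` distinct basis states is
`1 / (d (d + 1) ⋯ (d + m - 1))`, `d = 2 ^ n`. Averaging over the keys deletes the entries between
tuples in which some block changes its parity on the first `λ` bits. Call a tuple of `m = p ℓ + t`
basis states collision-free if its entries are distinct and distinct sets of `ℓ` entries have
distinct parities. A permutation of such a tuple that preserves the parities of the blocks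
preserves the blocks themselves, so there the entries of the real state are those of the ideal
state times a constant `≤ 1`. The states have the same trace, hence their trace distance is at most
the weight of the remaining tuples, `m ^ 2 / d` for repeated entries plus `m ^ (2 ℓ) / 2 ^ λ`
for equal parities. This is negligible when `ℓ log λ = o(λ)`. -/

noncomputable section

namespace CHS

open scoped BigOperators Matrix Kronecker ComplexOrder

/-! ### Printing the circuit -/

section Printer

/-- The circuit of the construction: a controlled `Z` from every key qubit to the state qubit with
the same index. -/
def phaseCircuit (lam : ℕ) : Circuit :=
  (List.range lam).map fun i => Gate.cz ⟨Reg.key, i⟩ ⟨Reg.st, i⟩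

theorem encodeCircuit_phaseCircuit_succ_append (i : ℕ) (o : List Sym) :
    encodeCircuit (phaseCircuit (i + 1)) ++ o = encodeCircuit (phaseCircuit i) ++
      (Sym.cz :: Sym.key :: (List.replicate i Sym.tick ++ (Sym.sep :: Sym.st ::
        (List.replicate i Sym.tick ++ (Sym.sep :: o))))) := by
  simp [phaseCircuit, List.range_succ, encodeCircuit, Gate.encode, Loc.encode, Reg.sym]

/-- The stacks of the Turing machine that prints `phaseCircuit`: a unary counter (initially the
input), an auxiliary stack on which the counter is saved while it is being printed, and the
output. -/
inductive PrinterStack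
  | input | aux | output
  deriving DecidableEq

instance : Fintype PrinterStack :=
  ⟨{.input, .aux, .output}, fun k => by cases k <;> decide⟩

/-- The labels of the printer: start the next gate, print the counter while moving it to the
auxiliary stack, print it again while moving it back. -/
inductive PrinterLabel
  | next | save | restore
  deriving DecidableEq

instance : Fintype PrinterLabel :=
  ⟨{.next, .save, .restore}, fun l => by cases l <;> decide⟩

/-- The stack alphabets of the printer. -/
def PrinterAlphabet : PrinterStack → Type
  | .output => Sym
  | _ => Bool

open PrinterStack PrinterLabel Turing.TM2.Stmt in
/-- The program of the printer. The output is a stack, so the gates are printed in decreasing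
order, each of them backwards. -/
def printerProgram : PrinterLabel → Turing.TM2.Stmt PrinterAlphabet PrinterLabel Bool
  | next => pop input (fun _ o => o.isSome) <| branch id
      (push output (fun _ => Sym.sep) <| goto fun _ => save) halt
  | save => pop input (fun _ o => o.isSome) <| branch id
      (push aux (fun _ => true) <| push output (fun _ => Sym.tick) <| goto fun _ => save)
      (push output (fun _ => Sym.st) <| push output (fun _ => Sym.sep) <| goto fun _ => restore)
  | restore => pop aux (fun _ o => o.isSome) <| branch id
      (push input (fun _ => true) <| push output (fun _ => Sym.tick) <| goto fun _ => restore)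
      (push output (fun _ => Sym.key) <| push output (fun _ => Sym.cz) <| goto fun _ => next)

/-- The Turing machine that prints `phaseCircuit lam` on input `1 ^ lam`. -/
def printer : Turing.FinTM2 where
  K := PrinterStack
  k₀ := .input
  k₁ := .output
  Γ := PrinterAlphabet
  Λ := PrinterLabel
  main := .next
  σ := Bool
  initialState := false
  Γk₀Fin := inferInstanceAs (Fintype Bool)
  m := printerProgram

/-- The number `i` in unary. -/
def marks (i : ℕ) : List Bool := List.replicate i true

/-- The stack contents of the printer with counter `i`, saved counter `a` and output `o`. -/
def printerStacks (i a : ℕ) (o : List Sym) : ∀ k, List (PrinterAlphabet k)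
  | .input => marks i
  | .aux => marks a
  | .output => o

/-- The configuration of the printer at label `l` (`none` if it has halted), with internal
state `v`. -/
def printerCfg (l : Option PrinterLabel) (v : Bool) (i a : ℕ) (o : List Sym) : printer.Cfg :=
  ⟨l, v, printerStacks i a o⟩

theorem printerCfg_eq_mk {l : Option PrinterLabel} {v : Bool} {i a : ℕ} {o : List Sym}
    {S : ∀ k, List (PrinterAlphabet k)} (hin : S .input = marks i) (haux : S .aux = marks a)
    (hout : S .output = o) : (⟨l, v, S⟩ : printer.Cfg) = printerCfg l v i a o :=
  congrArg (Turing.TM2.Cfg.mk l v) <| funext fun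
    | .input => hin
    | .aux => haux
    | .output => hout

theorem step_next_succ (v : Bool) (i : ℕ) (o : List Sym) :
    printer.step (printerCfg (some .next) v (i + 1) 0 o) =
      some (printerCfg (some .save) true i 0 (Sym.sep :: o)) :=
  congrArg some (printerCfg_eq_mk rfl rfl rfl)

theorem step_next_zero (v : Bool) (o : List Sym) :
    printer.step (printerCfg (some .next) v 0 0 o) = some (printerCfg none false 0 0 o) :=
  congrArg some (printerCfg_eq_mk rfl rfl rfl)

theorem step_save_succ (v : Bool) (i a : ℕ) (o : List Sym) :
    printer.step (printerCfg (some .save) v (i + 1) a o) =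
      some (printerCfg (some .save) true i (a + 1) (Sym.tick :: o)) :=
  congrArg some (printerCfg_eq_mk rfl rfl rfl)

theorem step_save_zero (v : Bool) (a : ℕ) (o : List Sym) :
    printer.step (printerCfg (some .save) v 0 a o) =
      some (printerCfg (some .restore) false 0 a (Sym.sep :: Sym.st :: o)) :=
  congrArg some (printerCfg_eq_mk rfl rfl rfl)

theorem step_restore_succ (v : Bool) (i a : ℕ) (o : List Sym) :
    printer.step (printerCfg (some .restore) v i (a + 1) o) =
      some (printerCfg (some .restore) true (i + 1) a (Sym.tick :: o)) :=
  congrArg some (printerCfg_eq_mk rfl rfl rfl)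

theorem step_restore_zero (v : Bool) (i : ℕ) (o : List Sym) :
    printer.step (printerCfg (some .restore) v i 0 o) =
      some (printerCfg (some .next) false i 0 (Sym.cz :: Sym.key :: o)) :=
  congrArg some (printerCfg_eq_mk rfl rfl rfl)

/-- `ReachesIn f m a b` says that `m` steps of the partial function `f` lead from `a` to `b`; it
is the proposition underlying the data `Turing.EvalsTo`. -/
def ReachesIn {σ : Type*} (f : σ → Option σ) (m : ℕ) (a b : σ) : Prop :=
  (flip bind f)^[m] (some a) = some b

theorem ReachesIn.head {σ : Type*} {f : σ → Option σ} {m : ℕ} {a b c : σ} (h : f a = some b)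
    (hbc : ReachesIn f m b c) : ReachesIn f (m + 1) a c :=
  (congrArg (flip bind f)^[m] h).trans hbc

theorem ReachesIn.single {σ : Type*} {f : σ → Option σ} {a b : σ} (h : f a = some b) :
    ReachesIn f 1 a b := h

theorem ReachesIn.trans {σ : Type*} {f : σ → Option σ} {m m' : ℕ} {a b c : σ}
    (hab : ReachesIn f m a b) (hbc : ReachesIn f m' b c) : ReachesIn f (m' + m) a c := by
  rw [ReachesIn, Function.iterate_add_apply, hab, hbc]

theorem reachesIn_save (v : Bool) (i a : ℕ) (o : List Sym) :
    ReachesIn printer.step (i + 1) (printerCfg (some .save) v i a o)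
      (printerCfg (some .restore) false 0 (a + i)
        (Sym.sep :: Sym.st :: (List.replicate i Sym.tick ++ o))) := by
  induction i generalizing v a o with
  | zero => exact .single (step_save_zero v a o)
  | succ i ih =>
    rw [List.replicate_succ', List.append_assoc, ← Nat.add_assoc a, Nat.add_right_comm a]
    exact (ih true (a + 1) (Sym.tick :: o)).head (step_save_succ v i a o)

theorem reachesIn_restore (v : Bool) (i a : ℕ) (o : List Sym) :
    ReachesIn printer.step (a + 1) (printerCfg (some .restore) v i a o)
      (printerCfg (some .next) false (i + a) 0
        (Sym.cz :: Sym.key :: (List.replicate a Sym.tick ++ o))) := by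
  induction a generalizing v i o with
  | zero => exact .single (step_restore_zero v i o)
  | succ a ih =>
    rw [List.replicate_succ', List.append_assoc, ← Nat.add_assoc, Nat.add_right_comm i]
    exact (ih true (i + 1) (Sym.tick :: o)).head (step_restore_succ v i a o)

theorem reachesIn_next (v : Bool) (i : ℕ) (o : List Sym) :
    ReachesIn printer.step (i ^ 2 + 2 * i + 1) (printerCfg (some .next) v i 0 o)
      (printerCfg none false 0 0 (encodeCircuit (phaseCircuit i) ++ o)) := by
  induction i generalizing v o with
  | zero => exact .single (step_next_zero v o)
  | succ i ih =>
    have saved := (reachesIn_save true i 0 (Sym.sep :: o)).head (step_next_succ v i o)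
    rw [Nat.zero_add] at saved
    have printed := saved.trans (reachesIn_restore false 0 i _)
    rw [Nat.zero_add] at printed
    rw [encodeCircuit_phaseCircuit_succ_append]
    convert printed.trans (ih false _) using 1
    ring

theorem unaryEncodeNat_eq_marks (m : ℕ) : Computability.unaryEncodeNat m = marks m := by
  induction m with
  | zero => rfl
  | succ m ih => exact congrArg (true :: ·) ih

/-- `printer` as a witness that the circuits `phaseCircuit lam` are printed in polynomial time. -/
def phaseCircuitComputable :
    Turing.TM2ComputableInPolyTime Computability.unaryEncodeNat encodeCircuit phaseCircuit where
  tm := printer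
  inputAlphabet := Equiv.refl Bool
  outputAlphabet := Equiv.refl Sym
  time := Polynomial.X ^ 2 + 2 * Polynomial.X + 1
  outputsFun m :=
    { steps := m ^ 2 + 2 * m + 1
      evals_in_steps := by
        have input : Turing.initList printer
            ((Computability.unaryEncodeNat m).map (Equiv.refl Bool).invFun) =
              printerCfg (some .next) false m 0 [] :=
          printerCfg_eq_mk ((List.map_id _).trans (unaryEncodeNat_eq_marks m)) rfl rfl
        have output : Turing.haltList printer
            ((encodeCircuit (phaseCircuit m)).map (Equiv.refl Sym).invFun) =
              printerCfg none false 0 0 (encodeCircuit (phaseCircuit m) ++ []) :=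
          printerCfg_eq_mk rfl rfl ((List.map_id _).trans (List.append_nil _).symm)
        exact (congrArg (fun c => (flip bind printer.step)^[_] (some c)) input).trans
          (Eq.trans (reachesIn_next false m []) (congrArg some output).symm)
      steps_le_m := by simp [unaryEncodeNat_eq_marks, marks] }

end Printer

/-! ### The phase channel -/

section TensorPi

variable {κ ι : Type} [Fintype κ]

theorem tensorPi_mul [DecidableEq κ] [Fintype ι] (A B : κ → Op ι) :
    tensorPi A * tensorPi B = tensorPi fun i => A i * B i := by
  ext x y
  simp only [tensorPi, Matrix.mul_apply, Matrix.of_apply, ← Finset.prod_mul_distrib]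
  rw [Finset.prod_univ_sum, Fintype.piFinset_univ]

theorem tensorPi_conjTranspose (A : κ → Op ι) : (tensorPi A)ᴴ = tensorPi fun i => (A i)ᴴ := by
  ext x y
  simp only [tensorPi, Matrix.conjTranspose_apply, Matrix.of_apply, star_prod]

open scoped MatrixOrder in
theorem posSemidef_tensorPi [Finite ι] {A : κ → Op ι} (hA : ∀ i, (A i).PosSemidef) :
    (tensorPi A).PosSemidef := by
  classical
  cases nonempty_fintype ι
  choose B hB using fun i => CStarAlgebra.nonneg_iff_eq_star_mul_self.1 (hA i).nonneg
  simp only [Matrix.star_eq_conjTranspose] at hB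
  rw [funext hB, ← tensorPi_mul, ← tensorPi_conjTranspose]
  exact Matrix.posSemidef_conjTranspose_mul_self _

theorem trace_tensorPi [DecidableEq κ] [Fintype ι] (A : κ → Op ι) :
    (tensorPi A).trace = ∏ i, (A i).trace := by
  simp only [Matrix.trace, Matrix.diag_apply, tensorPi, Matrix.of_apply]
  rw [Finset.prod_univ_sum, Fintype.piFinset_univ]

end TensorPi

section SignOp

variable {ι : Type} [DecidableEq ι]

/-- The diagonal unitary with entries `s x = ±1`. -/
def signOp (s : ι → ℤˣ) : Op ι := Matrix.diagonal fun x => ((s x : ℤ) : ℂ)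

theorem signOp_one : signOp (1 : ι → ℤˣ) = 1 := by
  simp [signOp]

theorem signOp_conjTranspose (s : ι → ℤˣ) : (signOp s)ᴴ = signOp s := by
  simp [signOp, Matrix.diagonal_conjTranspose, Pi.star_def]

theorem signOp_mul_signOp [Fintype ι] (s s' : ι → ℤˣ) :
    signOp s * signOp s' = signOp (s * s') := by
  simp [signOp, Matrix.diagonal_mul_diagonal]

theorem signOp_mul_mul_signOp_apply [Fintype ι] (s : ι → ℤˣ) (ρ : Op ι) (x y : ι) :
    (signOp s * ρ * signOp s) x y = ((s x * s y : ℤˣ) : ℤ) * ρ x y := by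
  rw [signOp, Matrix.mul_diagonal, Matrix.diagonal_mul]
  push_cast
  ring

theorem tensorPi_signOp {κ : Type} [Fintype κ] [DecidableEq (κ → ι)] (s : κ → ι → ℤˣ) :
    tensorPi (fun i => signOp (s i)) = signOp fun x => ∏ i, s i (x i) := by
  ext x y
  rw [tensorPi, Matrix.of_apply]
  by_cases h : x = y
  · subst h
    simp [signOp]
  · obtain ⟨i, hi⟩ := Function.ne_iff.1 h
    rw [signOp, Matrix.diagonal_apply_ne _ h]
    exact Finset.prod_eq_zero (Finset.mem_univ i) (Matrix.diagonal_apply_ne _ hi)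

theorem foldl_signOp_mul [Fintype ι] {α : Type} (L : List α) (s : α → ι → ℤˣ)
    (e : ι → ℤˣ) :
    L.foldl (fun U g => signOp (s g) * U) (signOp e) = signOp ((L.map s).prod * e) := by
  induction L generalizing e with
  | nil => simp
  | cons g L ih =>
    rw [List.foldl_cons, signOp_mul_signOp, ih, List.map_cons, List.prod_cons, ← mul_assoc,
      mul_comm (s g)]

end SignOp

section PhaseChannel

variable {lam n : ℕ}

/-- The sign `(-1) ^ b` of the bit `b`. -/
def bitSign (b : Bool) : ℤˣ := if b then -1 else 1

/-- The diagonal entries of `Z^k ⊗ I`. -/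
def phaseSign (n : ℕ) (k : Bits lam) (x : Bits n) : ℤˣ :=
  ∏ j : Fin n, if h : j.1 < lam then bitSign (k ⟨j.1, h⟩ && x j) else 1

theorem pauliZ_pow (b : Bool) : pauliZ ^ b.toNat = signOp fun a => bitSign (b && a) := by
  cases b <;> ext i j <;> cases i <;> cases j <;> simp [bitSign, signOp, pauliZ]

theorem phaseOp_eq_signOp (n : ℕ) (k : Bits lam) : phaseOp n k = signOp (phaseSign n k) := by
  have factor (j : Fin n) : (if h : j.1 < lam then pauliZ ^ (k ⟨j.1, h⟩).toNat else 1) =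
      signOp fun a => if h : j.1 < lam then bitSign (k ⟨j.1, h⟩ && a) else 1 := by
    split_ifs
    · exact pauliZ_pow _
    · exact signOp_one.symm
  rw [phaseOp, funext factor, tensorPi_signOp]
  rfl

theorem phaseMap_eq_signOp_mul_mul (n : ℕ) (k : Bits lam) (ρ : Op (Bits n)) :
    phaseMap n k ρ = signOp (phaseSign n k) * ρ * signOp (phaseSign n k) := by
  rw [phaseMap, phaseOp_eq_signOp, signOp_conjTranspose]

theorem phaseMap_apply (n : ℕ) (k : Bits lam) (ρ : Op (Bits n)) (x y : Bits n) :
    phaseMap n k ρ x y = ((phaseSign n k x * phaseSign n k y : ℤˣ) : ℤ) * ρ x y := by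
  rw [phaseMap_eq_signOp_mul_mul, signOp_mul_mul_signOp_apply]

theorem isChannel_phaseMap (n : ℕ) (k : Bits lam) : IsChannel (phaseMap n k) := by
  refine ⟨1, fun _ => phaseOp n k, ?_, fun ρ => by simp only [Fin.sum_univ_one, phaseMap]⟩
  rw [Fin.sum_univ_one, phaseOp_eq_signOp, signOp_conjTranspose, signOp_mul_signOp, ← signOp_one]
  exact congrArg signOp (funext fun x => Int.units_mul_self _)

theorem exists_phaseMap_density_eq (n : ℕ) (k : Bits lam) (ϑ : PureState n) :
    ∃ ϑ' : PureState n, phaseMap n k ϑ.density = ϑ'.density := by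
  refine ⟨⟨WithLp.toLp 2 fun x => ((phaseSign n k x : ℤ) : ℂ) * ϑ.1 x, ?_⟩, ?_⟩
  · have h := ϑ.2
    rw [mem_sphere_zero_iff_norm, EuclideanSpace.norm_eq] at h ⊢
    refine Eq.trans (congrArg Real.sqrt (Finset.sum_congr rfl fun x _ => ?_)) h
    rcases Int.units_eq_one_or (phaseSign n k x) with h | h <;> simp [h]
  · ext x y
    rw [phaseMap_apply]
    simp only [PureState.density, Matrix.of_apply, star_mul', star_intCast]
    push_cast
    ring

theorem phaseSign_eq_prod_castLE (hn : lam ≤ n) (k : Bits lam) (x : Bits n) :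
    phaseSign n k x = ∏ i : Fin lam, bitSign (k i && x (i.castLE hn)) := by
  symm
  refine Finset.prod_of_injOn (Fin.castLE hn) (Fin.castLE_injective hn).injOn
    (fun _ _ => Finset.mem_coe.2 (Finset.mem_univ _)) (fun j _ hj => dif_neg fun h => ?_)
    fun i _ => Eq.symm <| dif_pos (show (i.castLE hn).1 < lam from i.2)
  exact hj ⟨⟨j, h⟩, Finset.mem_coe.2 (Finset.mem_univ _), rfl⟩

theorem op_cz_key_st (a : ℕ) (hn : lam ≤ n) (i : Fin lam) :
    (Gate.cz ⟨Reg.key, i⟩ ⟨Reg.st, i⟩).op lam n a =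
      signOp fun x => bitSign (x (Sum.inl i) && x (Sum.inr (Sum.inl (i.castLE hn)))) := by
  simp only [Gate.op, Loc.wire, i.2, i.2.trans_le hn, dif_pos, reduceCtorEq, if_false, czOp,
    signOp]
  congr 1
  funext x
  simp only [bitSign, Fin.castLE]
  split_ifs <;> simp

theorem phaseCircuit_op (a : ℕ) (hn : lam ≤ n) :
    (phaseCircuit lam).op lam n a = signOp fun x => phaseSign n (fun i => x (Sum.inl i))
      (fun j => x (Sum.inr (Sum.inl j))) := by
  rw [Circuit.op, phaseCircuit, ← List.map_coe_finRange_eq_range, List.map_map, List.foldl_map,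
    ← signOp_one]
  simp only [Function.comp_apply, op_cz_key_st a hn]
  rw [foldl_signOp_mul, mul_one, ← Fin.prod_univ_def]
  congr 1
  funext x
  rw [phaseSign_eq_prod_castLE hn, Finset.prod_apply]

theorem phaseCircuit_ancillas (lam : ℕ) : (phaseCircuit lam).ancillas = 0 := by
  unfold phaseCircuit Circuit.ancillas
  induction List.range lam with
  | nil => rfl
  | cons i L ih => simpa [Gate.locs] using ih

theorem runWith_phaseCircuit (hn : lam ≤ n) (k : Bits lam) (ρ : Op (Bits n)) :
    runWith 0 (phaseCircuit lam) k ρ = phaseMap n k ρ := by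
  ext x y
  rw [phaseMap_apply, runWith, phaseCircuit_op 0 hn, signOp_conjTranspose, traceOut,
    Matrix.of_apply]
  simp only [signOp_mul_mul_signOp_apply, inputOp, Matrix.of_apply]
  rw [Finset.sum_eq_single k (fun k' _ hk => ?_) (by simp)]
  · simp [joinBits]
  · exact Finset.sum_eq_zero fun z _ => by simp [joinBits, hk]

theorem isQPT_phaseMap {n : ℕ → ℕ} (hn : ∀ lam, lam ≤ n lam) :
    IsQPT (n := n) fun lam k => phaseMap (lam := lam) (n lam) k := by
  refine ⟨phaseCircuit, ⟨phaseCircuitComputable⟩, fun lam k ρ => ?_⟩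
  rw [Circuit.run, phaseCircuit_ancillas, runWith_phaseCircuit (hn lam)]

end PhaseChannel

/-! ### The trace norm -/

section Compress

variable {ι : Type}

/-- The compression of an operator to the span of the basis vectors satisfying `p`. -/
def compress (p : ι → Prop) [DecidablePred p] (X : Op ι) : Op ι :=
  Matrix.of fun x y => if p x ∧ p y then X x y else 0

theorem posSemidef_compress [Finite ι] (p : ι → Prop) [DecidablePred p] {X : Op ι}
    (hX : X.PosSemidef) : (compress p X).PosSemidef := by
  classical
  cases nonempty_fintype ι
  have h : compress p X = (Matrix.diagonal fun x => if p x then (1 : ℂ) else 0)ᴴ * X *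
      Matrix.diagonal fun x => if p x then (1 : ℂ) else 0 := by
    ext x y
    rw [Matrix.diagonal_conjTranspose, Matrix.mul_diagonal, Matrix.diagonal_mul]
    by_cases hx : p x <;> by_cases hy : p y <;> simp [compress, hx, hy]
  rw [h]
  exact hX.conjTranspose_mul_mul_same _

theorem trace_compress [Fintype ι] (p : ι → Prop) [DecidablePred p] (X : Op ι) :
    (compress p X).trace = ∑ x with p x, X x x := by
  simp only [Matrix.trace, Matrix.diag_apply, compress, Matrix.of_apply, and_self,
    Finset.sum_filter]

theorem sub_eq_compress_sub_of_proportional {R S : Op ι} (hR : R.IsHermitian) (hS : S.IsHermitian)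
    (p : ι → Prop) [DecidablePred p] {α : ℝ} (hRS : ∀ x y, p x → R x y = α * S x y)
    (h0 : ∀ x y, p x → ¬ p y → S x y = 0) :
    R - S = compress (fun x => ¬ p x) R -
      (((1 - α : ℝ) : ℂ) • compress p S + compress (fun x => ¬ p x) S) := by
  have hR0 (x y) (hx : p x) (hy : ¬ p y) : R x y = 0 := by rw [hRS x y hx, h0 x y hx hy, mul_zero]
  ext x y
  simp only [Matrix.sub_apply, Matrix.add_apply, Matrix.smul_apply, compress, Matrix.of_apply,
    smul_eq_mul]
  by_cases hx : p x <;> by_cases hy : p y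
  · simp [hx, hy, hRS x y hx]
    ring
  · simp [hx, hy, hR0 x y hx hy, h0 x y hx hy]
  · simp [hx, hy, ← hR.apply x y, ← hS.apply x y, hR0 y x hy hx, h0 y x hy hx]
  · simp [hx, hy]

end Compress

section TraceNorm

variable {ι : Type} [Fintype ι] [DecidableEq ι]

theorem traceNorm_eq_sum_sqrt_roots_charpoly (X : Op ι) :
    traceNorm X = ((Xᴴ * X).charpoly.roots.map fun z => √z.re).sum := by
  rw [(Matrix.isHermitian_conjTranspose_mul_self X).roots_charpoly_eq_eigenvalues,
    Multiset.map_map]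
  simp only [Function.comp_def, RCLike.ofReal_eq_complex_ofReal, Complex.ofReal_re]
  rfl

theorem traceNorm_submatrix_equiv {κ : Type} [Fintype κ] [DecidableEq κ] (X : Op ι) (e : κ ≃ ι) :
    traceNorm (X.submatrix e e) = traceNorm X := by
  rw [traceNorm_eq_sum_sqrt_roots_charpoly, traceNorm_eq_sum_sqrt_roots_charpoly,
    Matrix.conjTranspose_submatrix, Matrix.submatrix_mul_equiv,
    show (Xᴴ * X).submatrix e e = Matrix.reindex e.symm e.symm (Xᴴ * X) from rfl,
    Matrix.charpoly_reindex]

theorem traceDist_submatrix_equiv {κ : Type} [Fintype κ] [DecidableEq κ] (R S : Op ι)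
    (e : κ ≃ ι) : traceDist (R.submatrix e e) (S.submatrix e e) = traceDist R S :=
  congrArg (· / 2) (traceNorm_submatrix_equiv (R - S) e)

theorem charpoly_conjTranspose_mul_self {X : Op ι} (hX : X.IsHermitian) :
    (Xᴴ * X).charpoly =
      ∏ i, (Polynomial.X - Polynomial.C (((hX.eigenvalues i) ^ 2 : ℝ) : ℂ)) := by
  have diagonalized : Xᴴ * X = Unitary.conjStarAlgAut ℂ _ hX.eigenvectorUnitary
      (Matrix.diagonal fun i => (((hX.eigenvalues i) ^ 2 : ℝ) : ℂ)) := by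
    rw [hX.eq]
    conv_lhs => rw [hX.spectral_theorem, ← map_mul, Matrix.diagonal_mul_diagonal]
    simp only [Function.comp_apply, RCLike.ofReal_eq_complex_ofReal, pow_two, Complex.ofReal_mul]
  rw [diagonalized, Unitary.conjStarAlgAut_apply, Matrix.charpoly_mul_comm, ← mul_assoc,
    Unitary.coe_star_mul_self, one_mul, Matrix.charpoly_diagonal]

theorem traceNorm_eq_sum_abs_eigenvalues {X : Op ι} (hX : X.IsHermitian) :
    traceNorm X = ∑ i, |hX.eigenvalues i| := by
  rw [traceNorm_eq_sum_sqrt_roots_charpoly, charpoly_conjTranspose_mul_self hX,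
    Polynomial.roots_prod _ _ (Finset.prod_ne_zero_iff.2 fun i _ => Polynomial.X_sub_C_ne_zero _)]
  simp only [Polynomial.roots_X_sub_C, Multiset.bind_singleton, Multiset.map_map,
    Function.comp_def, Complex.ofReal_re, Real.sqrt_sq_eq_abs]
  rfl

theorem traceDist_self (R : Op ι) : traceDist R R = 0 := by
  rw [traceDist, sub_self, traceNorm_eq_sum_abs_eigenvalues Matrix.isHermitian_zero,
    (Matrix.isHermitian_zero.eigenvalues_eq_zero_iff).2 rfl]
  simp

theorem sum_eigenvectorBasis_eq_trace {X : Op ι} (hX : X.IsHermitian) (P : Op ι) :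
    ∑ i, (star ⇑(hX.eigenvectorBasis i) ⬝ᵥ (P *ᵥ ⇑(hX.eigenvectorBasis i))) = P.trace := by
  set U : Op ι := (hX.eigenvectorUnitary : Matrix.unitaryGroup ι ℂ).1
  have hU : U * Uᴴ = 1 := Unitary.mul_star_self_of_mem hX.eigenvectorUnitary.2
  have conj : (Uᴴ * P * U).trace = P.trace := by
    rw [Matrix.trace_mul_comm, ← mul_assoc, hU, one_mul]
  rw [← conj, Matrix.trace]
  refine Finset.sum_congr rfl fun i _ => ?_
  rw [Matrix.diag_apply, mul_assoc, Matrix.mul_apply]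
  rfl

theorem traceNorm_sub_le {P Q : Op ι} (hP : P.PosSemidef) (hQ : Q.PosSemidef) :
    traceNorm (P - Q) ≤ P.trace.re + Q.trace.re := by
  have hX : (P - Q).IsHermitian := hP.1.sub hQ.1
  rw [traceNorm_eq_sum_abs_eigenvalues hX, ← sum_eigenvectorBasis_eq_trace hX P,
    ← sum_eigenvectorBasis_eq_trace hX Q, Complex.re_sum, Complex.re_sum, ← Finset.sum_add_distrib]
  refine Finset.sum_le_sum fun i _ => ?_
  have hPi := hP.re_dotProduct_nonneg (hX.eigenvectorBasis i)
  have hQi := hQ.re_dotProduct_nonneg (hX.eigenvectorBasis i)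
  rw [hX.eigenvalues_eq, Matrix.sub_mulVec, dotProduct_sub, map_sub]
  exact (abs_sub _ _).trans_eq (congrArg₂ _ (abs_of_nonneg hPi) (abs_of_nonneg hQi))

theorem abs_trace_mul_re_le {X M : Op ι} (hX : X.IsHermitian) (htr : X.trace = 0)
    (hM : M.PosSemidef) (hM' : (1 - M).PosSemidef) :
    |(M * X).trace.re| ≤ traceNorm X / 2 := by
  set v := fun i => ⇑(hX.eigenvectorBasis i)
  set m := fun i => (star (v i) ⬝ᵥ (M *ᵥ v i)).re
  have hsum : ∑ i, hX.eigenvalues i = 0 := by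
    have h := hX.trace_eq_sum_eigenvalues
    rw [htr] at h
    exact Complex.ofReal_eq_zero.1 ((Complex.ofReal_sum _ _).trans h.symm)
  have expand : (M * X).trace.re = ∑ i, hX.eigenvalues i * (m i - 1 / 2) := by
    have h (i : ι) : (star (v i) ⬝ᵥ ((M * X) *ᵥ v i)).re = hX.eigenvalues i * m i := by
      rw [← Matrix.mulVec_mulVec, hX.mulVec_eigenvectorBasis, Matrix.mulVec_smul, dotProduct_smul,
        Complex.smul_re, smul_eq_mul]
    simp_rw [mul_sub, Finset.sum_sub_distrib, ← Finset.sum_mul, hsum, zero_mul, sub_zero, ← h,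
      ← Complex.re_sum, v, sum_eigenvectorBasis_eq_trace]
  have hm (i : ι) : |m i - 1 / 2| ≤ 1 / 2 := by
    have h0 : 0 ≤ m i := hM.re_dotProduct_nonneg (v i)
    have h1 : 0 ≤ 1 - m i := by
      have h := hM'.re_dotProduct_nonneg (v i)
      have hv : star (v i) ⬝ᵥ v i = 1 := by
        rw [dotProduct_comm]
        simp [v, ← EuclideanSpace.inner_eq_star_dotProduct]
      rwa [Matrix.sub_mulVec, Matrix.one_mulVec, dotProduct_sub, hv, map_sub, RCLike.one_re] at h
    rw [abs_le]
    constructor <;> linarith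
  rw [expand, traceNorm_eq_sum_abs_eigenvalues hX, Finset.sum_div]
  refine (Finset.abs_sum_le_sum_abs _ _).trans (Finset.sum_le_sum fun i _ => ?_)
  rw [abs_mul, div_eq_mul_one_div |hX.eigenvalues i|]
  exact mul_le_mul_of_nonneg_left (hm i) (abs_nonneg _)

theorem Test.abs_prob_sub_prob_le_traceDist (A : Test ι) {R S : Op ι} (hR : R.IsHermitian)
    (hS : S.IsHermitian) (htr : R.trace = S.trace) :
    |A.prob R - A.prob S| ≤ traceDist R S := by
  rw [Test.prob, Test.prob, ← Complex.sub_re, ← Matrix.trace_sub, ← mul_sub]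
  exact abs_trace_mul_re_le (hR.sub hS) (by rw [Matrix.trace_sub, htr, sub_self]) A.pos A.le_one

theorem traceDist_le_of_proportional {R S : Op ι} (hR : R.PosSemidef) (hS : S.PosSemidef)
    (htr : R.trace = S.trace) (p : ι → Prop) [DecidablePred p] {α : ℝ} (hα : α ≤ 1)
    (hRS : ∀ x y, p x → R x y = α * S x y) (h0 : ∀ x y, p x → ¬ p y → S x y = 0) :
    traceDist R S ≤ ∑ x with ¬ p x, (R x x).re := by
  set P := compress (fun x => ¬ p x) R
  set Q := ((1 - α : ℝ) : ℂ) • compress p S + compress (fun x => ¬ p x) S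
  have hRS_eq : R - S = P - Q := sub_eq_compress_sub_of_proportional hR.1 hS.1 p hRS h0
  have hQ : Q.PosSemidef := ((posSemidef_compress p hS).smul
    (Complex.zero_le_real.2 (sub_nonneg.2 hα))).add (posSemidef_compress _ hS)
  have hPQ : P.trace = Q.trace := by
    rw [← sub_eq_zero, ← Matrix.trace_sub, ← hRS_eq, Matrix.trace_sub, htr, sub_self]
  calc traceDist R S = traceNorm (P - Q) / 2 := by rw [traceDist, hRS_eq]
    _ ≤ (P.trace.re + Q.trace.re) / 2 := by
      gcongr
      exact traceNorm_sub_le (posSemidef_compress _ hR) hQ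
    _ = P.trace.re := by rw [← hPQ, add_self_div_two]
    _ = ∑ x with ¬ p x, (R x x).re := by rw [trace_compress, Complex.re_sum]

end TraceNorm

/-! ### Unitarily invariant measures on the unit sphere -/

section UnitaryInvariance

open MeasureTheory

/-- The action of a linear isometry on the unit sphere. -/
def sphereHomeo {𝕜 E : Type*} [RCLike 𝕜] [NormedAddCommGroup E] [NormedSpace 𝕜 E]
    (U : E ≃ₗᵢ[𝕜] E) : Metric.sphere (0 : E) 1 ≃ₜ Metric.sphere (0 : E) 1 :=
  U.toHomeomorph.subtype fun v => by
    rw [mem_sphere_zero_iff_norm, mem_sphere_zero_iff_norm, LinearIsometryEquiv.coe_toHomeomorph,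
      U.norm_map]

open scoped Pointwise in
theorem measurePreserving_sphereHomeo_toSphere {E : Type*} [NormedAddCommGroup E]
    [InnerProductSpace ℝ E] [FiniteDimensional ℝ E] [MeasurableSpace E] [BorelSpace E]
    (U : E ≃ₗᵢ[ℝ] E) :
    MeasurePreserving (sphereHomeo U) (volume : Measure E).toSphere
      (volume : Measure E).toSphere := by
  refine ⟨(sphereHomeo U).measurable, Measure.ext fun s hs => ?_⟩
  have cone : Set.Ioo (0 : ℝ) 1 • ((↑) '' (sphereHomeo U ⁻¹' s) : Set E) =
      U ⁻¹' (Set.Ioo (0 : ℝ) 1 • ((↑) '' s)) := by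
    ext v
    constructor
    · rintro ⟨r, hr, _, ⟨ϑ, hϑ, rfl⟩, rfl⟩
      exact ⟨r, hr, _, ⟨_, hϑ, rfl⟩, (U.map_smul r ϑ.1).symm⟩
    · rintro ⟨r, hr, _, ⟨ϑ, hϑ, rfl⟩, h⟩
      refine ⟨r, hr, _, ⟨(sphereHomeo U).symm ϑ, ?_, rfl⟩, ?_⟩
      · rwa [Set.mem_preimage, Homeomorph.apply_symm_apply]
      · exact U.injective ((U.map_smul _ _).trans
          ((congrArg (r • ·) (U.apply_symm_apply ϑ.1)).trans h))
  rw [Measure.map_apply (sphereHomeo U).measurable hs, Measure.toSphere_apply' _ hs,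
    Measure.toSphere_apply' _ ((sphereHomeo U).measurable hs), cone,
    U.measurePreserving.measure_preimage_emb U.toHomeomorph.measurableEmbedding]

/-- The unit sphere of the Hilbert space with orthonormal basis `ι`. -/
abbrev UnitSphere (ι : Type) [Fintype ι] : Type := Metric.sphere (0 : EuclideanSpace ℂ ι) 1

/-- Invariance of a measure on the unit sphere under all unitaries. -/
class IsUnitarilyInvariant {ι : Type} [Fintype ι] (μ : Measure (UnitSphere ι)) : Prop where
  measurePreserving (U : EuclideanSpace ℂ ι ≃ₗᵢ[ℂ] EuclideanSpace ℂ ι) :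
    MeasurePreserving (sphereHomeo U) μ μ

instance (n : ℕ) : IsUnitarilyInvariant (haarState n) where
  measurePreserving U := (measurePreserving_sphereHomeo_toSphere
    { U.toLinearEquiv.restrictScalars ℝ with norm_map' := U.norm_map }).smul_measure _

variable {ι : Type} [Fintype ι] {μ : Measure (UnitSphere ι)}

theorem integral_sphereHomeo [IsUnitarilyInvariant μ] {F : Type} [NormedAddCommGroup F]
    [NormedSpace ℝ F] (U : EuclideanSpace ℂ ι ≃ₗᵢ[ℂ] EuclideanSpace ℂ ι) (g : UnitSphere ι → F) :
    ∫ ϑ, g (sphereHomeo U ϑ) ∂μ = ∫ ϑ, g ϑ ∂μ :=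
  (IsUnitarilyInvariant.measurePreserving U).integral_comp (sphereHomeo U).measurableEmbedding g

theorem integrable_of_continuous [IsFiniteMeasure μ] {F : Type} [NormedAddCommGroup F]
    {f : UnitSphere ι → F} (hf : Continuous f) : Integrable f μ :=
  hf.integrable_of_hasCompactSupport (HasCompactSupport.of_compactSpace f)

@[fun_prop]
theorem continuous_amplitude (b : ι) : Continuous fun ϑ : UnitSphere ι => ϑ.1 b :=
  (EuclideanSpace.proj b : EuclideanSpace ℂ ι →L[ℂ] ℂ).continuous.comp continuous_subtype_val

theorem sum_norm_amplitude_sq (ϑ : UnitSphere ι) : ∑ b, ‖ϑ.1 b‖ ^ 2 = 1 := by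
  rw [← EuclideanSpace.norm_sq_eq, norm_eq_of_mem_sphere ϑ, one_pow]

/-- The diagonal unitary with entries `u b`. -/
def phaseIsometry (u : ι → Circle) : EuclideanSpace ℂ ι ≃ₗᵢ[ℂ] EuclideanSpace ℂ ι :=
  LinearIsometryEquiv.piLpCongrRight 2 fun b =>
    { DistribMulAction.toLinearEquiv ℂ ℂ (u b) with
      norm_map' := fun z => by simp [Circle.smul_def, Circle.norm_coe] }

theorem sphereHomeo_phaseIsometry_apply (u : ι → Circle) (ϑ : UnitSphere ι) (b : ι) :
    (sphereHomeo (phaseIsometry u) ϑ).1 b = u b * ϑ.1 b := rfl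

/-- The permutation `σ` of the basis as a unitary. -/
def permIsometry (σ : Equiv.Perm ι) : EuclideanSpace ℂ ι ≃ₗᵢ[ℂ] EuclideanSpace ℂ ι :=
  LinearIsometryEquiv.piLpCongrLeft 2 ℂ ℂ σ

theorem sphereHomeo_permIsometry_apply (σ : Equiv.Perm ι) (ϑ : UnitSphere ι) (b : ι) :
    (sphereHomeo (permIsometry σ) ϑ).1 b = ϑ.1 (σ.symm b) := rfl

/-- The reflection fixing `e_b + 2 e_c`: up to a sign on `e_b`, the rotation of the plane of `e_b`
and `e_c` by the angle of the 3-4-5 triangle. -/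
def mixIsometry [DecidableEq ι] (b c : ι) : EuclideanSpace ℂ ι ≃ₗᵢ[ℂ] EuclideanSpace ℂ ι :=
  Submodule.reflection (ℂ ∙ (EuclideanSpace.single b (1 : ℂ) + EuclideanSpace.single c 2))

theorem sphereHomeo_mixIsometry_apply [DecidableEq ι] {b c : ι} (hbc : b ≠ c)
    (ϑ : UnitSphere ι) (a : ι) : (sphereHomeo (mixIsometry b c) ϑ).1 a =
      2 / 5 * (ϑ.1 b + 2 * ϑ.1 c) * ((if a = b then 1 else 0) + if a = c then 2 else 0) -
        ϑ.1 a := by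
  have hinner : inner ℂ (EuclideanSpace.single b (1 : ℂ) + EuclideanSpace.single c 2) ϑ.1 =
      ϑ.1 b + 2 * ϑ.1 c := by
    simp [EuclideanSpace.inner_single_left, Complex.conj_ofNat]
  have hnorm : ‖EuclideanSpace.single b (1 : ℂ) + EuclideanSpace.single c (2 : ℂ)‖ ^ 2 = 5 := by
    rw [norm_add_sq (𝕜 := ℂ), EuclideanSpace.inner_single_left, PiLp.norm_single, PiLp.norm_single,
      PiLp.single_apply, if_neg hbc]
    norm_num
  change mixIsometry b c ϑ.1 a = _
  rw [mixIsometry, Submodule.reflection_singleton_apply, hinner]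
  norm_cast
  rw [hnorm]
  simp only [PiLp.sub_apply, PiLp.smul_apply, PiLp.add_apply, PiLp.single_apply, smul_eq_mul,
    nsmul_eq_mul]
  push_cast
  ring

end UnitaryInvariance

section SquareMoments

open MeasureTheory

variable {ι : Type} [Fintype ι] {μ : Measure (UnitSphere ι)} [IsUnitarilyInvariant μ]

theorem integral_norm_pow_mul_prod_swap {S : Finset ι} {b c : ι} (hb : b ∉ S) (hc : c ∉ S)
    (m : ℕ) :
    ∫ ϑ : UnitSphere ι, ‖ϑ.1 b‖ ^ m * ∏ a ∈ S, ‖ϑ.1 a‖ ^ 2 ∂μ =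
      ∫ ϑ : UnitSphere ι, ‖ϑ.1 c‖ ^ m * ∏ a ∈ S, ‖ϑ.1 a‖ ^ 2 ∂μ := by
  classical
  rw [← integral_sphereHomeo (permIsometry (Equiv.swap b c))]
  simp only [sphereHomeo_permIsometry_apply, Equiv.symm_swap, Equiv.swap_apply_left]
  congr! 3 with ϑ
  refine Finset.prod_congr rfl fun a ha => ?_
  rw [Equiv.swap_apply_of_ne_of_ne (ne_of_mem_of_not_mem ha hb) (ne_of_mem_of_not_mem ha hc)]

theorem sum_norm_I_pow_mul_add_pow_four (x y : ℂ) :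
    ∑ k ∈ Finset.range 4, ‖Complex.I ^ k * x + y‖ ^ 4 =
      4 * ‖x‖ ^ 4 + 16 * (‖x‖ ^ 2 * ‖y‖ ^ 2) + 4 * ‖y‖ ^ 4 := by
  have h2 (z : ℂ) : ‖z‖ ^ 2 = z.re ^ 2 + z.im ^ 2 := by
    rw [Complex.sq_norm, Complex.normSq_apply]; ring
  have h4 (z : ℂ) : ‖z‖ ^ 4 = (z.re ^ 2 + z.im ^ 2) ^ 2 := by rw [← h2]; ring
  simp [Finset.sum_range_succ, h2, h4, pow_succ]
  ring

theorem integral_norm_add_pow_four_mul_prod [IsFiniteMeasure μ] (S : Finset ι) {b c : ι}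
    (hbc : b ≠ c) (α β : ℂ) :
    ∫ ϑ : UnitSphere ι, ‖α * ϑ.1 b + β * ϑ.1 c‖ ^ 4 * ∏ a ∈ S, ‖ϑ.1 a‖ ^ 2 ∂μ =
      ‖α‖ ^ 4 * ∫ ϑ : UnitSphere ι, ‖ϑ.1 b‖ ^ 4 * ∏ a ∈ S, ‖ϑ.1 a‖ ^ 2 ∂μ +
      4 * ‖α‖ ^ 2 * ‖β‖ ^ 2 *
        ∫ ϑ : UnitSphere ι, ‖ϑ.1 b‖ ^ 2 * ‖ϑ.1 c‖ ^ 2 * ∏ a ∈ S, ‖ϑ.1 a‖ ^ 2 ∂μ +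
      ‖β‖ ^ 4 * ∫ ϑ : UnitSphere ι, ‖ϑ.1 c‖ ^ 4 * ∏ a ∈ S, ‖ϑ.1 a‖ ^ 2 ∂μ := by
  classical
  set w : UnitSphere ι → ℝ := fun ϑ => ∏ a ∈ S, ‖ϑ.1 a‖ ^ 2
  have hw : Continuous w := by fun_prop
  have phase (u : Circle) : ∫ ϑ : UnitSphere ι, ‖u * (α * ϑ.1 b) + β * ϑ.1 c‖ ^ 4 * w ϑ ∂μ =
      ∫ ϑ : UnitSphere ι, ‖α * ϑ.1 b + β * ϑ.1 c‖ ^ 4 * w ϑ ∂μ := by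
    rw [← integral_sphereHomeo (phaseIsometry (Function.update 1 b u)) fun ϑ =>
      ‖α * ϑ.1 b + β * ϑ.1 c‖ ^ 4 * w ϑ]
    congr! 3 with ϑ
    · simp only [sphereHomeo_phaseIsometry_apply, Function.update_self,
        Function.update_of_ne hbc.symm, Pi.one_apply, Circle.coe_one, one_mul,
        mul_left_comm (u : ℂ)]
    · refine Finset.prod_congr rfl fun a _ => ?_
      rw [sphereHomeo_phaseIsometry_apply, norm_mul, Circle.norm_coe, one_mul]
  obtain ⟨i, hi⟩ : ∃ i : Circle, (i : ℂ) = Complex.I :=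
    ⟨Circle.exp (Real.pi / 2), by rw [Circle.coe_exp]; simp [Complex.exp_pi_div_two_mul_I]⟩
  have average := Finset.sum_congr (rfl : Finset.range 4 = _) fun k _ => phase (i ^ k)
  rw [← integral_finsetSum _ fun k _ => integrable_of_continuous (by fun_prop), Finset.sum_const,
    Finset.card_range, nsmul_eq_mul, ← inv_mul_eq_iff_eq_mul₀ (by norm_num)] at average
  refine average.symm.trans ?_
  rw [← integral_const_mul, ← integral_const_mul, ← integral_const_mul, ← integral_const_mul,
    ← integral_add (integrable_of_continuous (by fun_prop))
    (integrable_of_continuous (by fun_prop)), ← integral_add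
    (integrable_of_continuous (by fun_prop)) (integrable_of_continuous (by fun_prop))]
  congr! 2 with ϑ
  rw [← Finset.sum_mul]
  simp only [Circle.coe_pow, hi]
  rw [sum_norm_I_pow_mul_add_pow_four, norm_mul, norm_mul]
  push_cast
  ring

theorem integral_norm_pow_four_mul_prod [IsFiniteMeasure μ] {S : Finset ι} {b c : ι} (hbc : b ≠ c)
    (hb : b ∉ S) (hc : c ∉ S) :
    ∫ ϑ : UnitSphere ι, ‖ϑ.1 b‖ ^ 4 * ∏ a ∈ S, ‖ϑ.1 a‖ ^ 2 ∂μ =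
      2 * ∫ ϑ : UnitSphere ι, ‖ϑ.1 b‖ ^ 2 * ‖ϑ.1 c‖ ^ 2 * ∏ a ∈ S, ‖ϑ.1 a‖ ^ 2 ∂μ := by
  classical
  have mix : ∫ ϑ : UnitSphere ι, ‖ϑ.1 b‖ ^ 4 * ∏ a ∈ S, ‖ϑ.1 a‖ ^ 2 ∂μ =
      ∫ ϑ : UnitSphere ι, ‖-3 / 5 * ϑ.1 b + 4 / 5 * ϑ.1 c‖ ^ 4 * ∏ a ∈ S, ‖ϑ.1 a‖ ^ 2 ∂μ := by
    rw [← integral_sphereHomeo (mixIsometry b c)]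
    congr! 3 with ϑ
    · rw [sphereHomeo_mixIsometry_apply hbc, if_pos rfl, if_neg hbc]
      congr 2
      ring
    · refine Finset.prod_congr rfl fun a ha => ?_
      simp [sphereHomeo_mixIsometry_apply hbc, ne_of_mem_of_not_mem ha hb,
        ne_of_mem_of_not_mem ha hc]
  rw [integral_norm_add_pow_four_mul_prod S hbc, ← integral_norm_pow_mul_prod_swap hb hc] at mix
  norm_num at mix
  linarith

variable (μ) in
/-- The moment `E ∏_{b ∈ S} |ϑ_b|²`. -/
def sqMoment (S : Finset ι) : ℝ := ∫ ϑ, ∏ b ∈ S, ‖ϑ.1 b‖ ^ 2 ∂μ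

theorem sqMoment_eq_mul_sqMoment_insert [IsFiniteMeasure μ] [DecidableEq ι] {S : Finset ι} {c : ι}
    (hc : c ∉ S) :
    sqMoment μ S = (Fintype.card ι + S.card : ℝ) * sqMoment μ (insert c S) := by
  have expand : sqMoment μ S =
      ∑ b, ∫ ϑ : UnitSphere ι, ‖ϑ.1 b‖ ^ 2 * ∏ a ∈ S, ‖ϑ.1 a‖ ^ 2 ∂μ := by
    rw [← integral_finsetSum _ fun b _ => integrable_of_continuous (by fun_prop)]
    simp only [← Finset.sum_mul, sum_norm_amplitude_sq, one_mul, sqMoment]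
  have outside {b} (hb : b ∉ S) :
      ∫ ϑ : UnitSphere ι, ‖ϑ.1 b‖ ^ 2 * ∏ a ∈ S, ‖ϑ.1 a‖ ^ 2 ∂μ = sqMoment μ (insert c S) := by
    rw [integral_norm_pow_mul_prod_swap hb hc, sqMoment]
    simp only [Finset.prod_insert hc]
  have inside {b} (hb : b ∈ S) : ∫ ϑ : UnitSphere ι, ‖ϑ.1 b‖ ^ 2 * ∏ a ∈ S, ‖ϑ.1 a‖ ^ 2 ∂μ =
      2 * sqMoment μ (insert c S) := by
    have h := integral_norm_pow_four_mul_prod (μ := μ) (ne_of_mem_of_not_mem hb hc)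
      (Finset.notMem_erase b S) fun h => hc (Finset.mem_of_mem_erase h)
    simp only [sqMoment, Finset.prod_insert hc, ← Finset.mul_prod_erase S _ hb]
    convert h using 3
    · ring
    · funext ϑ
      ring
  rw [expand, ← Finset.sum_add_sum_compl S, Finset.sum_congr rfl fun b hb => inside hb,
    Finset.sum_congr rfl fun b hb => outside (Finset.mem_compl.1 hb), Finset.sum_const,
    Finset.sum_const, Finset.card_compl, nsmul_eq_mul, nsmul_eq_mul,
    Nat.cast_sub (Finset.card_le_univ S)]
  ring

theorem sqMoment_eq [IsProbabilityMeasure μ] (S : Finset ι) :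
    sqMoment μ S = (((Fintype.card ι).ascFactorial S.card : ℕ) : ℝ)⁻¹ := by
  classical
  induction S using Finset.induction_on with
  | empty => simp [sqMoment]
  | insert c S hc ih =>
    have hpos : (Fintype.card ι + S.card : ℝ) ≠ 0 := by
      have : 0 < Fintype.card ι := Fintype.card_pos_iff.2 ⟨c⟩
      positivity
    rw [sqMoment_eq_mul_sqMoment_insert hc, ← eq_inv_mul_iff_mul_eq₀ hpos] at ih
    rw [ih, Finset.card_insert_of_notMem hc, Nat.ascFactorial_succ, Nat.cast_mul, mul_inv]
    push_cast
    rfl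

end SquareMoments

section Moments

open MeasureTheory

variable {ι : Type} [Fintype ι] (μ : Measure (UnitSphere ι)) (κ : Type) [Fintype κ]

/-- The moment operator `E |ϑ⟩⟨ϑ|^{⊗ κ}` of a measure on the unit sphere. -/
def momentOp : Op (κ → ι) :=
  Matrix.of fun x y => ∫ ϑ, ∏ i, (ϑ.1 (x i) * star (ϑ.1 (y i))) ∂μ

variable {κ}

theorem momentOp_apply_self (x : κ → ι) :
    momentOp μ κ x x = ((∫ ϑ, ∏ i, ‖ϑ.1 (x i)‖ ^ 2 ∂μ : ℝ) : ℂ) := by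
  rw [momentOp, Matrix.of_apply, ← integral_complex_ofReal]
  congr! 2 with ϑ
  push_cast
  exact Finset.prod_congr rfl fun i _ => Complex.mul_conj' _

theorem momentOp_comp_perm (x y : κ → ι) (σ : Equiv.Perm κ) :
    momentOp μ κ x (y ∘ σ) = momentOp μ κ x y := by
  simp only [momentOp, Matrix.of_apply, Finset.prod_mul_distrib]
  congr! 3 with ϑ
  exact Equiv.prod_comp σ fun i => star (ϑ.1 (y i))

theorem momentOp_apply_self_of_injective [IsUnitarilyInvariant μ] [IsProbabilityMeasure μ]
    {x : κ → ι} (hx : Function.Injective x) :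
    momentOp μ κ x x = ((((Fintype.card ι).ascFactorial (Fintype.card κ) : ℕ) : ℂ))⁻¹ := by
  classical
  have h := sqMoment_eq (μ := μ) (Finset.univ.image x)
  rw [Finset.card_image_of_injective _ hx, Finset.card_univ] at h
  rw [momentOp_apply_self, ← Complex.ofReal_natCast, ← Complex.ofReal_inv, ← h, sqMoment]
  simp only [Finset.prod_image hx.injOn]

theorem trace_momentOp [DecidableEq κ] [IsProbabilityMeasure μ] : (momentOp μ κ).trace = 1 := by
  have sum_one (ϑ : UnitSphere ι) : ∑ x : κ → ι, ∏ i, ‖ϑ.1 (x i)‖ ^ 2 = 1 := by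
    rw [← Fintype.prod_sum fun (_ : κ) b => ‖ϑ.1 b‖ ^ 2]
    simp only [sum_norm_amplitude_sq, Finset.prod_const_one]
  simp only [Matrix.trace, Matrix.diag_apply, momentOp_apply_self]
  rw [← Complex.ofReal_sum, ← integral_finsetSum _ fun x _ =>
    integrable_of_continuous (by fun_prop)]
  simp [sum_one]

theorem posSemidef_integral_mul_star {Ω ι : Type} [MeasurableSpace Ω] {μ : Measure Ω}
    {f : Ω → ι → ℂ} (hf : ∀ x y, Integrable (fun ω => f ω x * star (f ω y)) μ) :
    (Matrix.of fun x y => ∫ ω, f ω x * star (f ω y) ∂μ : Op ι).PosSemidef := by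
  have hermitian :
      (Matrix.of fun x y => ∫ ω, f ω x * star (f ω y) ∂μ : Op ι).IsHermitian := by
    ext x y
    rw [Matrix.conjTranspose_apply, Matrix.of_apply, Matrix.of_apply, Complex.star_def,
      ← integral_conj]
    simp [mul_comm]
  refine ⟨hermitian, fun v => ?_⟩
  have expand (ω) : ((‖∑ x ∈ v.support, star (v x) * f ω x‖ ^ 2 : ℝ) : ℂ) =
      ∑ x ∈ v.support, ∑ y ∈ v.support, star (v x) * (f ω x * star (f ω y)) * v y := by
    push_cast
    rw [← Complex.mul_conj', map_sum, Finset.sum_mul_sum]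
    refine Finset.sum_congr rfl fun x _ => Finset.sum_congr rfl fun y _ => ?_
    simp only [map_mul, Complex.star_def, Complex.conj_conj]
    ring
  have quadratic_form :
      (v.sum fun x a => v.sum fun y b => star a * (∫ ω, f ω x * star (f ω y) ∂μ) * b) =
        ((∫ ω, ‖∑ x ∈ v.support, star (v x) * f ω x‖ ^ 2 ∂μ : ℝ) : ℂ) := by
    rw [← integral_complex_ofReal]
    simp only [expand, Finsupp.sum]
    rw [integral_finsetSum _ fun x _ => integrable_finsetSum _ fun y _ =>
      ((hf x y).const_mul _).mul_const _]
    refine Finset.sum_congr rfl fun x _ => ?_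
    rw [integral_finsetSum _ fun y _ => ((hf x y).const_mul _).mul_const _]
    simp only [integral_mul_const, integral_const_mul]
  exact quadratic_form.symm ▸  Complex.zero_le_real.2 (integral_nonneg fun _ => by positivity)

theorem posSemidef_momentOp [IsFiniteMeasure μ] : (momentOp μ κ).PosSemidef := by
  classical
  simp only [momentOp, Finset.prod_mul_distrib, ← star_prod]
  exact posSemidef_integral_mul_star fun x y => integrable_of_continuous (by fun_prop)

variable {μ}

theorem prod_phase_eq_of_momentOp_ne_zero [IsUnitarilyInvariant μ] {x y : κ → ι}
    (h : momentOp μ κ x y ≠ 0) (u : ι → Circle) : ∏ i, u (x i) = ∏ i, u (y i) := by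
  have invariance : momentOp μ κ x y =
      Circle.coeHom (∏ i, u (x i) / u (y i)) * momentOp μ κ x y := by
    conv_lhs => rw [momentOp, Matrix.of_apply, ← integral_sphereHomeo (phaseIsometry u)]
    rw [momentOp, Matrix.of_apply, ← integral_const_mul]
    congr! 2
    rw [map_prod, ← Finset.prod_mul_distrib]
    refine Finset.prod_congr rfl fun i _ => ?_
    have coe_div : Circle.coeHom (u (x i) / u (y i)) = u (x i) * star (u (y i) : ℂ) :=
      congrArg (_ * ·) (Circle.coe_inv_eq_conj _)
    rw [sphereHomeo_phaseIsometry_apply, sphereHomeo_phaseIsometry_apply, star_mul', coe_div]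
    ring
  have ratio := (mul_right_cancel₀ h ((one_mul _).trans invariance)).symm
  exact div_eq_one.1 ((Finset.prod_div_distrib ..).symm.trans (Circle.coe_eq_one.1 ratio))

theorem exists_perm_of_card_fiber_eq {α β : Type} [Fintype α] [DecidableEq β] {x y : α → β}
    (h : ∀ b, (Finset.univ.filter (x · = b)).card = (Finset.univ.filter (y · = b)).card) :
    ∃ σ : Equiv.Perm α, y = x ∘ σ := by
  have fiberEquiv (b : β) : {i // y i = b} ≃ {i // x i = b} :=
    Fintype.equivOfCardEq (by rw [Fintype.card_subtype, Fintype.card_subtype, h])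
  exact ⟨Equiv.ofFiberEquiv fiberEquiv, funext fun i => (Equiv.ofFiberEquiv_map _ i).symm⟩

theorem exists_perm_of_momentOp_ne_zero [IsUnitarilyInvariant μ] {x y : κ → ι}
    (h : momentOp μ κ x y ≠ 0) : ∃ σ : Equiv.Perm κ, y = x ∘ σ := by
  classical
  refine exists_perm_of_card_fiber_eq fun b => ?_
  set N := Fintype.card κ + 1
  have primitive : IsPrimitiveRoot (Circle.exp (2 * Real.pi / N) : ℂ) N := by
    convert Complex.isPrimitiveRoot_exp N (Nat.succ_ne_zero _) using 1
    rw [Circle.coe_exp]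
    push_cast
    ring_nf
  have card_lt (z : κ → ι) : (Finset.univ.filter (z · = b)).card < N :=
    Nat.lt_succ_of_le (Finset.card_le_univ _)
  have pow_eq := prod_phase_eq_of_momentOp_ne_zero h fun a =>
    if a = b then Circle.exp (2 * Real.pi / N) else 1
  simp only [← Finset.prod_filter, Finset.prod_const] at pow_eq
  exact primitive.pow_inj (card_lt x) (card_lt y)
    (by simpa only [Circle.coe_pow] using congrArg ((↑) : Circle → ℂ) pow_eq)

end Moments

/-! ### Entries of the real and the ideal state -/

section Parity

variable {lam n : ℕ} {κ : Type}

/-- The parities of the first `lam` bits of the sum of the entries `x a`, `a ∈ A`, as signs. -/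
def parity (hn : lam ≤ n) (x : κ → Bits n) (A : Finset κ) : Fin lam → ℤˣ := fun j =>
  ∏ a ∈ A, bitSign (x a (j.castLE hn))

theorem expect_prod_pi {K α : Type} [Semifield K] [CharZero K] [Fintype κ] [DecidableEq κ]
    [Fintype α] (g : κ → α → K) : (𝔼 k : κ → α, ∏ i, g i (k i)) = ∏ i, 𝔼 a, g i a := by
  simp only [Fintype.expect_eq_sum_div_card]
  rw [Finset.prod_div_distrib, Fintype.prod_sum, Finset.prod_const, Fintype.card_fun,
    Finset.card_univ, Nat.cast_pow]

theorem expect_units_ite (u : ℤˣ) :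
    (𝔼 b : Bool, (((if b then u else 1 : ℤˣ) : ℤ) : ℂ)) = if u = 1 then 1 else 0 := by
  rw [Fintype.expect_eq_sum_div_card, Fintype.sum_bool]
  rcases Int.units_eq_one_or u with rfl | rfl
  · norm_num
  · simp

theorem expect_prod_phaseSign [Fintype κ] (hn : lam ≤ n) (x y : κ → Bits n) :
    (𝔼 k : Bits lam, ∏ a, (((phaseSign n k (x a) * phaseSign n k (y a) : ℤˣ) : ℤ) : ℂ)) =
      if parity hn x Finset.univ = parity hn y Finset.univ then 1 else 0 := by
  have prod_sign (k : Bits lam) (z : κ → Bits n) : ∏ a, phaseSign n k (z a) =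
      ∏ j, if k j then parity hn z Finset.univ j else 1 := by
    simp only [phaseSign_eq_prod_castLE hn]
    rw [Finset.prod_comm]
    refine Finset.prod_congr rfl fun j _ => ?_
    cases k j <;> simp [parity, bitSign]
  have factor (k : Bits lam) :
      ∏ a, (((phaseSign n k (x a) * phaseSign n k (y a) : ℤˣ) : ℤ) : ℂ) =
        ∏ j, (((if k j then parity hn x Finset.univ j * parity hn y Finset.univ j else 1 : ℤˣ) :
          ℤ) : ℂ) := by
    rw [← Int.cast_prod, ← Int.cast_prod, ← Units.coe_prod, ← Units.coe_prod,
      Finset.prod_mul_distrib, prod_sign, prod_sign, ← Finset.prod_mul_distrib]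
    congr! 3 with j
    split_ifs <;> simp
  simp only [factor]
  rw [expect_prod_pi fun j (b : Bool) =>
    (((if b then parity hn x Finset.univ j * parity hn y Finset.univ j else 1 : ℤˣ) : ℤ) : ℂ)]
  simp only [expect_units_ite, mul_eq_one_iff_eq_inv, Int.units_inv_eq_self]
  simp [Fintype.prod_boole, funext_iff]

end Parity

section States

open MeasureTheory

variable {lam n ℓ t p : ℕ}

/-- The entries of the `p` blocks and of the copies of the common state, as one tuple. -/
def flat : ((Fin p → Fin ℓ → Bits n) × (Fin t → Bits n)) ≃ (Fin p × Fin ℓ ⊕ Fin t → Bits n) :=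
  ((Equiv.curry (Fin p) (Fin ℓ) (Bits n)).symm.prodCongr (Equiv.refl _)).trans
    (Equiv.sumArrowEquivProdArrow _ _ _).symm

@[simp]
theorem flat_inl (x : (Fin p → Fin ℓ → Bits n) × (Fin t → Bits n)) (i : Fin p) (j : Fin ℓ) :
    flat x (Sum.inl (i, j)) = x.1 i j := rfl

@[simp]
theorem flat_inr (x : (Fin p → Fin ℓ → Bits n) × (Fin t → Bits n)) (j : Fin t) :
    flat x (Sum.inr j) = x.2 j := rfl

/-- The parities of all `p` blocks, the quantity that the random keys decohere. -/
def blockParity (hn : lam ≤ n) (x : (Fin p → Fin ℓ → Bits n) × (Fin t → Bits n)) :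
    Fin p → Fin lam → ℤˣ := fun i =>
  parity hn (x.1 i) Finset.univ

theorem integral_tensor_phaseMap_apply (k : Fin p → Bits lam)
    (x y : (Fin p → Fin ℓ → Bits n) × (Fin t → Bits n)) :
    ∫ ϑ : PureState n, (tensorPi (fun i => tensorPow (phaseMap n (k i) ϑ.density) ℓ) ⊗ₖ
        tensorPow ϑ.density t) x y ∂haarState n =
      (∏ i, ∏ j, (((phaseSign n (k i) (x.1 i j) * phaseSign n (k i) (y.1 i j) : ℤˣ) : ℤ) : ℂ)) *
        momentOp (haarState n) _ (flat x) (flat y) := by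
  rw [momentOp, Matrix.of_apply, ← integral_const_mul]
  congr 1 with ϑ
  rw [Matrix.kroneckerMap_apply, Fintype.prod_sum_type, Fintype.prod_prod_type, ← mul_assoc]
  simp only [← Finset.prod_mul_distrib, tensorPi, tensorPow, Matrix.of_apply, phaseMap_apply,
    PureState.density, flat_inl, flat_inr]

theorem realStateMulti_apply (hn : lam ≤ n)
    (x y : (Fin p → Fin ℓ → Bits n) × (Fin t → Bits n)) :
    realStateMulti (phaseMap (lam := lam) n) ℓ t p x y =
      if blockParity hn x = blockParity hn y then momentOp (haarState n) _ (flat x) (flat y)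
      else 0 := by
  rw [realStateMulti, Matrix.of_apply]
  simp only [integral_tensor_phaseMap_apply]
  rw [← Finset.expect_mul, expect_prod_pi fun i (k : Bits lam) =>
    ∏ j, (((phaseSign n k (x.1 i j) * phaseSign n k (y.1 i j) : ℤˣ) : ℤ) : ℂ)]
  simp only [expect_prod_phaseSign hn]
  rw [Fintype.prod_boole, ite_mul, one_mul, zero_mul]
  simp only [funext_iff, blockParity]

theorem realStateMulti_apply_self (hn : lam ≤ n)
    (x : (Fin p → Fin ℓ → Bits n) × (Fin t → Bits n)) :
    realStateMulti (phaseMap (lam := lam) n) ℓ t p x x =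
      momentOp (haarState n) _ (flat x) (flat x) := by
  rw [realStateMulti_apply hn, if_pos rfl]

theorem realStateMulti_eq_sum_compress (hn : lam ≤ n) :
    realStateMulti (phaseMap (lam := lam) n) ℓ t p = ∑ v, compress (blockParity hn · = v)
      ((momentOp (haarState n) (Fin p × Fin ℓ ⊕ Fin t)).submatrix flat flat) := by
  ext x y
  rw [realStateMulti_apply hn, Matrix.sum_apply]
  simp only [compress, Matrix.of_apply, Matrix.submatrix_apply]
  rw [Finset.sum_eq_single (blockParity hn y) (fun v _ hv => if_neg fun h => hv h.2.symm) (by simp)]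
  simp only [and_true]

theorem posSemidef_realStateMulti (hn : lam ≤ n) :
    (realStateMulti (phaseMap (lam := lam) n) ℓ t p).PosSemidef := by
  rw [realStateMulti_eq_sum_compress hn]
  exact Matrix.posSemidef_sum _ fun v _ =>
    posSemidef_compress _ ((posSemidef_momentOp _).submatrix _)

theorem trace_realStateMulti (hn : lam ≤ n) :
    (realStateMulti (phaseMap (lam := lam) n) ℓ t p).trace = 1 := by
  simp only [Matrix.trace, Matrix.diag_apply, realStateMulti_apply_self hn]
  rw [Equiv.sum_comp flat fun x => momentOp (haarState n) (Fin p × Fin ℓ ⊕ Fin t) x x]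
  exact trace_momentOp (haarState n)

theorem idealStateMulti_eq_kronecker : idealStateMulti n ℓ t p =
    tensorPi (fun _ : Fin p => momentOp (haarState n) (Fin ℓ)) ⊗ₖ
      momentOp (haarState n) (Fin t) := by
  ext x y
  rw [idealStateMulti, Matrix.of_apply]
  simp only [Matrix.kroneckerMap_apply]
  rw [integral_prod_mul (fun ω : Fin p → PureState n =>
      tensorPi (fun i => tensorPow (ω i).density ℓ) x.1 y.1)
    fun ϑ : PureState n => tensorPow ϑ.density t x.2 y.2]
  exact congrArg (· * _) (integral_fintype_prod_eq_prod (μ := fun _ : Fin p => haarState n)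
    fun i (ϑ : PureState n) => tensorPow ϑ.density ℓ (x.1 i) (y.1 i))

theorem idealStateMulti_apply (x y : (Fin p → Fin ℓ → Bits n) × (Fin t → Bits n)) :
    idealStateMulti n ℓ t p x y = (∏ i, momentOp (haarState n) _ (x.1 i) (y.1 i)) *
      momentOp (haarState n) _ x.2 y.2 := by
  rw [idealStateMulti_eq_kronecker]
  rfl

theorem posSemidef_idealStateMulti : (idealStateMulti n ℓ t p).PosSemidef := by
  rw [idealStateMulti_eq_kronecker]
  exact (posSemidef_tensorPi fun _ => posSemidef_momentOp _).kronecker (posSemidef_momentOp _)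

theorem trace_idealStateMulti : (idealStateMulti n ℓ t p).trace = 1 := by
  simp only [idealStateMulti_eq_kronecker, Matrix.trace_kronecker, trace_tensorPi, trace_momentOp,
    Finset.prod_const_one, mul_one]

theorem realState_eq_submatrix (ℓ t : ℕ) : realState (phaseMap (lam := lam) n) ℓ t =
    (realStateMulti (phaseMap (lam := lam) n) ℓ t 1).submatrix
      ((Equiv.funUnique (Fin 1) _).symm.prodCongr (Equiv.refl _))
      ((Equiv.funUnique (Fin 1) _).symm.prodCongr (Equiv.refl _)) := by
  ext x y
  rw [realState, Matrix.submatrix_apply, realStateMulti, Matrix.of_apply, Matrix.of_apply]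
  refine (Fintype.expect_equiv (Equiv.funUnique (Fin 1) (Bits lam)) _ _ fun k => ?_).symm
  congr 1 with ϑ
  simp [Matrix.kroneckerMap_apply, tensorPi]

theorem idealState_eq_submatrix (n ℓ t : ℕ) : idealState n ℓ t =
    (idealStateMulti n ℓ t 1).submatrix
      ((Equiv.funUnique (Fin 1) _).symm.prodCongr (Equiv.refl _))
      ((Equiv.funUnique (Fin 1) _).symm.prodCongr (Equiv.refl _)) := by
  ext x y
  rw [Matrix.submatrix_apply, idealStateMulti_apply, idealState, Matrix.of_apply]
  simp only [Matrix.kroneckerMap_apply]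
  rw [integral_prod_mul (fun φ : PureState n => tensorPow φ.density ℓ x.1 y.1)
    fun ϑ : PureState n => tensorPow ϑ.density t x.2 y.2, Fin.prod_univ_one]
  rfl

end States

/-! ### Collision-free tuples -/

section CollisionFree

variable {lam n ℓ t p : ℕ}

/-- The tuples with distinct entries in which distinct sets of `ℓ` entries have distinct parities.
-/
structure CollisionFree {κ : Type} (hn : lam ≤ n) (ℓ : ℕ) (x : κ → Bits n) : Prop where
  injective : Function.Injective x
  parity_injOn : {A : Finset κ | A.card = ℓ}.InjOn (parity hn x)

theorem parity_map {κ κ' : Type} (hn : lam ≤ n) (x : κ → Bits n) (f : κ' ↪ κ) (A : Finset κ') :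
    parity hn x (A.map f) = parity hn (x ∘ f) A :=
  funext fun _ => Finset.prod_map A f _

theorem CollisionFree.comp_perm {κ : Type} {hn : lam ≤ n} {x : κ → Bits n}
    (hx : CollisionFree hn ℓ x) (σ : Equiv.Perm κ) : CollisionFree hn ℓ (x ∘ σ) where
  injective := hx.injective.comp σ.injective
  parity_injOn A hA B hB hAB := Finset.map_injective σ.toEmbedding <|
    hx.parity_injOn ((Finset.card_map _).trans hA) ((Finset.card_map _).trans hB) <| by
      rw [parity_map, parity_map]
      exact hAB

/-- The positions of the `i`-th block. -/
def block (ℓ t : ℕ) (i : Fin p) : Finset (Fin p × Fin ℓ ⊕ Fin t) :=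
  Finset.univ.map ((Function.Embedding.sectR i (Fin ℓ)).trans Function.Embedding.inl)

theorem mem_block {i : Fin p} {a : Fin p × Fin ℓ ⊕ Fin t} :
    a ∈ block ℓ t i ↔ ∃ j, a = Sum.inl (i, j) := by
  simp [block, eq_comm]

theorem card_block (i : Fin p) : (block ℓ t i).card = ℓ := by
  simp [block]

theorem parity_flat_block (hn : lam ≤ n) (x : (Fin p → Fin ℓ → Bits n) × (Fin t → Bits n))
    (i : Fin p) : parity hn (flat x) (block ℓ t i) = blockParity hn x i :=
  parity_map hn _ _ _

theorem injective_fst_of_injective_flat {x : (Fin p → Fin ℓ → Bits n) × (Fin t → Bits n)}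
    (hx : Function.Injective (flat x)) (i : Fin p) : Function.Injective (x.1 i) :=
  hx.comp (Sum.inl_injective.comp (Prod.mk_right_injective i))

theorem injective_snd_of_injective_flat {x : (Fin p → Fin ℓ → Bits n) × (Fin t → Bits n)}
    (hx : Function.Injective (flat x)) : Function.Injective x.2 :=
  hx.comp Sum.inr_injective

/-- Equality up to permutations within each of the `p` blocks and within the copies of the common
state. -/
def BlockwisePerm (x y : (Fin p → Fin ℓ → Bits n) × (Fin t → Bits n)) : Prop :=
  (∀ i, ∃ σ : Equiv.Perm (Fin ℓ), y.1 i = x.1 i ∘ σ) ∧ ∃ τ : Equiv.Perm (Fin t), y.2 = x.2 ∘ τ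

theorem BlockwisePerm.exists_perm_flat {x y : (Fin p → Fin ℓ → Bits n) × (Fin t → Bits n)}
    (h : BlockwisePerm x y) : ∃ σ : Equiv.Perm (Fin p × Fin ℓ ⊕ Fin t), flat y = flat x ∘ σ := by
  obtain ⟨hσ, τ, hτ⟩ := h
  choose σ hσ using hσ
  refine ⟨Equiv.sumCongr (Equiv.prodCongrRight σ) τ, funext ?_⟩
  rintro (⟨i, j⟩ | j)
  · exact congrFun (hσ i) j
  · exact congrFun hτ j

theorem BlockwisePerm.blockParity_eq {hn : lam ≤ n}
    {x y : (Fin p → Fin ℓ → Bits n) × (Fin t → Bits n)} (h : BlockwisePerm x y) :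
    blockParity hn x = blockParity hn y := by
  funext i
  obtain ⟨σ, hσ⟩ := h.1 i
  rw [blockParity, blockParity, hσ]
  exact funext fun j => (Equiv.prod_comp σ fun a => bitSign (x.1 i a (j.castLE hn))).symm

theorem exists_perm_of_forall_exists_eq {κ β : Type} [Finite κ] {x y : κ → β}
    (hy : Function.Injective y) (h : ∀ i, ∃ j, y i = x j) : ∃ σ : Equiv.Perm κ, y = x ∘ σ := by
  choose f hf using h
  have hf_inj : Function.Injective f := fun i j hij => hy (by rw [hf, hf, hij])
  exact ⟨Equiv.ofBijective f (Finite.injective_iff_bijective.1 hf_inj), funext hf⟩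

theorem BlockwisePerm.of_map_block {x y : (Fin p → Fin ℓ → Bits n) × (Fin t → Bits n)}
    (hx : Function.Injective (flat x)) {σ : Equiv.Perm (Fin p × Fin ℓ ⊕ Fin t)}
    (hσ : flat y = flat x ∘ σ) (hblock : ∀ i, (block ℓ t i).map σ.toEmbedding = block ℓ t i) :
    BlockwisePerm x y := by
  have hy : Function.Injective (flat y) := hσ ▸ hx.comp σ.injective
  have mem_iff (a) (i : Fin p) : σ a ∈ block ℓ t i ↔ a ∈ block ℓ t i := by
    conv_lhs => rw [← hblock i]
    exact Finset.mem_map' σ.toEmbedding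
  refine ⟨fun i => exists_perm_of_forall_exists_eq (injective_fst_of_injective_flat hy i)
    fun j => ?_, exists_perm_of_forall_exists_eq (injective_snd_of_injective_flat hy) fun j => ?_⟩
  · obtain ⟨j', hj'⟩ := mem_block.1 ((mem_iff (Sum.inl (i, j)) i).2 (mem_block.2 ⟨j, rfl⟩))
    exact ⟨j', (congrFun hσ _).trans (congrArg (flat x) hj')⟩
  · rcases hj : σ (Sum.inr j) with ⟨i, j'⟩ | j'
    · have : Sum.inr j ∈ block ℓ t i := (mem_iff _ i).1 (hj ▸ mem_block.2 ⟨j', rfl⟩)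
      simp [mem_block] at this
    · exact ⟨j', (congrFun hσ _).trans (congrArg (flat x) hj)⟩

theorem BlockwisePerm.of_realStateMulti_ne_zero (hn : lam ≤ n)
    {x y : (Fin p → Fin ℓ → Bits n) × (Fin t → Bits n)} (hx : CollisionFree hn ℓ (flat x))
    (h : realStateMulti (phaseMap (lam := lam) n) ℓ t p x y ≠ 0) : BlockwisePerm x y := by
  rw [realStateMulti_apply hn, ne_eq, ite_eq_right_iff, Classical.not_imp] at h
  obtain ⟨hparity, hmoment⟩ := h
  obtain ⟨σ, hσ⟩ := exists_perm_of_momentOp_ne_zero hmoment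
  refine .of_map_block hx.injective hσ fun i => ?_
  refine hx.parity_injOn ((Finset.card_map _).trans (card_block i)) (card_block i) ?_
  calc parity hn (flat x) ((block ℓ t i).map σ.toEmbedding)
      = parity hn (flat x ∘ σ) (block ℓ t i) := parity_map hn _ _ _
    _ = blockParity hn y i := by rw [← hσ, parity_flat_block]
    _ = parity hn (flat x) (block ℓ t i) := by rw [← hparity, parity_flat_block]

theorem BlockwisePerm.of_idealStateMulti_ne_zero
    {x y : (Fin p → Fin ℓ → Bits n) × (Fin t → Bits n)} (h : idealStateMulti n ℓ t p x y ≠ 0) :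
    BlockwisePerm x y := by
  rw [idealStateMulti_apply, mul_ne_zero_iff, Finset.prod_ne_zero_iff] at h
  exact ⟨fun i => exists_perm_of_momentOp_ne_zero (h.1 i (Finset.mem_univ i)),
    exists_perm_of_momentOp_ne_zero h.2⟩

theorem idealStateMulti_eq_zero_of_collisionFree (hn : lam ≤ n)
    {x y : (Fin p → Fin ℓ → Bits n) × (Fin t → Bits n)} (hx : CollisionFree hn ℓ (flat x))
    (hy : ¬ CollisionFree hn ℓ (flat y)) : idealStateMulti n ℓ t p x y = 0 := by
  by_contra h
  obtain ⟨σ, hσ⟩ := (BlockwisePerm.of_idealStateMulti_ne_zero h).exists_perm_flat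
  exact hy (hσ ▸ hx.comp_perm σ)

end CollisionFree

section Proportional

variable {lam n ℓ t p : ℕ}

theorem ascFactorial_pos_of_pos {d : ℕ} (hd : 0 < d) (m : ℕ) : 0 < d.ascFactorial m :=
  (pow_pos hd m).trans_le (Nat.pow_succ_le_ascFactorial d m)

theorem ascFactorial_mul_ascFactorial_le (d a b : ℕ) :
    d.ascFactorial a * d.ascFactorial b ≤ d.ascFactorial (a + b) := by
  rw [← Nat.ascFactorial_mul_ascFactorial]
  exact Nat.mul_le_mul_left _ (Nat.ascFactorial_le b (Nat.le_add_right d a))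

theorem ascFactorial_pow_mul_ascFactorial_le (d ℓ t p : ℕ) :
    d.ascFactorial ℓ ^ p * d.ascFactorial t ≤ d.ascFactorial (p * ℓ + t) := by
  induction p with
  | zero => simp
  | succ p ih =>
    calc d.ascFactorial ℓ ^ (p + 1) * d.ascFactorial t
        = d.ascFactorial ℓ * (d.ascFactorial ℓ ^ p * d.ascFactorial t) := by ring
      _ ≤ d.ascFactorial ℓ * d.ascFactorial (p * ℓ + t) := Nat.mul_le_mul_left _ ih
      _ ≤ d.ascFactorial (ℓ + (p * ℓ + t)) := ascFactorial_mul_ascFactorial_le _ _ _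
      _ = d.ascFactorial ((p + 1) * ℓ + t) := by ring_nf

/-- The ratio of the nonzero entries of the real and of the ideal state in the collision-free
rows. -/
def entryRatio (n ℓ t p : ℕ) : ℝ :=
  (((2 ^ n).ascFactorial ℓ ^ p * (2 ^ n).ascFactorial t : ℕ) : ℝ) /
    ((2 ^ n).ascFactorial (p * ℓ + t) : ℕ)

theorem entryRatio_le_one (n ℓ t p : ℕ) : entryRatio n ℓ t p ≤ 1 :=
  div_le_one_of_le₀ (Nat.cast_le.2 (ascFactorial_pow_mul_ascFactorial_le _ _ _ _))
    (Nat.cast_nonneg _)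

theorem realStateMulti_apply_eq_entryRatio_mul (hn : lam ≤ n)
    {x : (Fin p → Fin ℓ → Bits n) × (Fin t → Bits n)} (hx : CollisionFree hn ℓ (flat x))
    (y : (Fin p → Fin ℓ → Bits n) × (Fin t → Bits n)) :
    realStateMulti (phaseMap (lam := lam) n) ℓ t p x y =
      entryRatio n ℓ t p * idealStateMulti n ℓ t p x y := by
  by_cases hxy : BlockwisePerm x y
  swap
  · rw [not_imp_comm.1 (BlockwisePerm.of_realStateMulti_ne_zero hn hx) hxy,
      not_imp_comm.1 BlockwisePerm.of_idealStateMulti_ne_zero hxy, mul_zero]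
  have real_entry : realStateMulti (phaseMap (lam := lam) n) ℓ t p x y =
      (((2 ^ n).ascFactorial (p * ℓ + t) : ℕ) : ℂ)⁻¹ := by
    obtain ⟨σ, hσ⟩ := hxy.exists_perm_flat
    rw [realStateMulti_apply hn, if_pos hxy.blockParity_eq, hσ, momentOp_comp_perm,
      momentOp_apply_self_of_injective _ hx.injective]
    simp
  have ideal_entry : idealStateMulti n ℓ t p x y =
      (((2 ^ n).ascFactorial ℓ ^ p * (2 ^ n).ascFactorial t : ℕ) : ℂ)⁻¹ := by
    obtain ⟨hσ, τ, hτ⟩ := hxy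
    choose σ hσ using hσ
    rw [idealStateMulti_apply, hτ, momentOp_comp_perm,
      momentOp_apply_self_of_injective _ (injective_snd_of_injective_flat hx.injective)]
    simp only [hσ, momentOp_comp_perm, momentOp_apply_self_of_injective _
      (injective_fst_of_injective_flat hx.injective _)]
    simp [mul_comm]
  have hpos : (((2 ^ n).ascFactorial ℓ ^ p * (2 ^ n).ascFactorial t : ℕ) : ℂ) ≠ 0 := by
    have h (m : ℕ) : (2 ^ n).ascFactorial m ≠ 0 := (ascFactorial_pos_of_pos (by positivity) m).ne'
    exact Nat.cast_ne_zero.2 (mul_ne_zero (pow_ne_zero p (h ℓ)) (h t))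
  rw [real_entry, ideal_entry, entryRatio, Complex.ofReal_div, Complex.ofReal_natCast,
    Complex.ofReal_natCast, div_mul_eq_mul_div, mul_inv_cancel₀ hpos, one_div]

open Classical in
theorem traceDist_realStateMulti_le_sum (hn : lam ≤ n) (ℓ t p : ℕ) :
    traceDist (realStateMulti (phaseMap (lam := lam) n) ℓ t p) (idealStateMulti n ℓ t p) ≤
      ∑ x : Fin p × Fin ℓ ⊕ Fin t → Bits n with ¬ CollisionFree hn ℓ x,
        (momentOp (haarState n) _ x x).re := by
  refine (traceDist_le_of_proportional (posSemidef_realStateMulti hn) posSemidef_idealStateMulti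
    ((trace_realStateMulti hn).trans trace_idealStateMulti.symm)
    (fun x => CollisionFree hn ℓ (flat x)) (entryRatio_le_one n ℓ t p)
    (fun x y hx => realStateMulti_apply_eq_entryRatio_mul hn hx y)
    fun x y => idealStateMulti_eq_zero_of_collisionFree hn).trans_eq ?_
  simp only [realStateMulti_apply_self hn, Finset.sum_filter]
  exact Equiv.sum_comp flat fun x => if ¬ CollisionFree hn ℓ x then
    (momentOp (haarState n) _ x x).re else 0

end Proportional

/-! ### The weight of the tuples with a collision -/

section InjectiveWeight

open MeasureTheory

theorem ascFactorial_mul_le (d m : ℕ) :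
    d.ascFactorial m * d ≤ d.descFactorial m * d + m ^ 2 * d.ascFactorial m := by
  induction m with
  | zero => simp
  | succ m ih =>
    rw [Nat.ascFactorial_succ, Nat.descFactorial_succ]
    rcases le_total m d with hmd | hdm
    · obtain ⟨e, rfl⟩ := Nat.exists_eq_add_of_le hmd
      rw [Nat.add_sub_cancel_left]
      linarith [Nat.mul_le_mul_left e ih,
        Nat.zero_le ((2 * m ^ 3 + 2 * m ^ 2 + 2 * m + e) * (m + e).ascFactorial m)]
    · rw [Nat.sub_eq_zero_of_le hdm, zero_mul, zero_mul, zero_add, mul_comm]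
      exact Nat.mul_le_mul_right _ (hdm.trans (by nlinarith))

theorem one_sub_descFactorial_div_ascFactorial_le {d : ℕ} (hd : 0 < d) (m : ℕ) :
    1 - (d.descFactorial m : ℝ) / d.ascFactorial m ≤ (m : ℝ) ^ 2 / d := by
  have hasc : (0 : ℝ) < d.ascFactorial m := by exact_mod_cast ascFactorial_pos_of_pos hd m
  have hd' : (0 : ℝ) < d := by exact_mod_cast hd
  have h : (d.ascFactorial m : ℝ) * d ≤ d.descFactorial m * d + m ^ 2 * d.ascFactorial m := by
    exact_mod_cast ascFactorial_mul_le d m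
  rw [one_sub_div hasc.ne', div_le_div_iff₀ hasc hd']
  linarith

theorem card_filter_injective {κ ι : Type} [Fintype κ] [Fintype ι] [DecidableEq κ]
    [DecidablePred (Function.Injective : (κ → ι) → Prop)] :
    (Finset.univ.filter fun x : κ → ι => Function.Injective x).card =
      (Fintype.card ι).descFactorial (Fintype.card κ) := by
  rw [← Fintype.card_subtype, Fintype.card_congr (Equiv.subtypeInjectiveEquivEmbedding _ _),
    Fintype.card_embedding_eq]

variable {ι κ : Type} [Fintype ι] [Fintype κ] (μ : Measure (UnitSphere ι))
  [IsProbabilityMeasure μ] [IsUnitarilyInvariant μ]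

theorem momentOp_apply_self_re_of_injective {x : κ → ι} (hx : Function.Injective x) :
    (momentOp μ κ x x).re = ((Fintype.card ι).ascFactorial (Fintype.card κ) : ℝ)⁻¹ := by
  rw [momentOp_apply_self_of_injective μ hx, ← Complex.ofReal_natCast, ← Complex.ofReal_inv,
    Complex.ofReal_re]

theorem momentOp_apply_self_re_le_of_injective [Nonempty ι] {x : κ → ι}
    (hx : Function.Injective x) :
    (momentOp μ κ x x).re ≤ ((Fintype.card ι : ℝ) ^ Fintype.card κ)⁻¹ := by
  rw [momentOp_apply_self_re_of_injective μ hx]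
  refine inv_anti₀ (pow_pos (Nat.cast_pos.2 Fintype.card_pos) _) ?_
  exact_mod_cast Nat.pow_succ_le_ascFactorial (Fintype.card ι) (Fintype.card κ)

theorem sum_momentOp_not_injective_le [Nonempty ι] [DecidableEq κ]
    [DecidablePred (Function.Injective : (κ → ι) → Prop)] :
    ∑ x : κ → ι with ¬ Function.Injective x, (momentOp μ κ x x).re ≤
      (Fintype.card κ : ℝ) ^ 2 / Fintype.card ι := by
  have total : ∑ x : κ → ι, (momentOp μ κ x x).re = 1 := by
    rw [← Complex.re_sum]
    exact congrArg Complex.re (trace_momentOp μ)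
  have injective_part : ∑ x : κ → ι with Function.Injective x, (momentOp μ κ x x).re =
      (Fintype.card ι).descFactorial (Fintype.card κ) /
        (Fintype.card ι).ascFactorial (Fintype.card κ) := by
    rw [Finset.sum_congr rfl fun x hx =>
      momentOp_apply_self_re_of_injective μ (Finset.mem_filter.1 hx).2, Finset.sum_const,
      card_filter_injective, nsmul_eq_mul, div_eq_mul_inv]
  rw [← Finset.sum_filter_add_sum_filter_not _ Function.Injective, injective_part] at total
  rw [← sub_eq_of_eq_add' total.symm]
  exact one_sub_descFactorial_div_ascFactorial_le Fintype.card_pos _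

end InjectiveWeight

section ParityCollision

variable {lam n : ℕ}

/-- The bit string `y` with its first `lam` bits added to `v`. -/
def flipFirst (v : Bits lam) (y : Bits n) : Bits n := fun j =>
  if h : j.1 < lam then xor (v ⟨j, h⟩) (y j) else y j

theorem flipFirst_flipFirst (v : Bits lam) (y : Bits n) : flipFirst v (flipFirst v y) = y := by
  funext j
  by_cases h : j.1 < lam <;> simp [flipFirst, h]

theorem bitSign_xor (a b : Bool) : bitSign (xor a b) = bitSign a * bitSign b := by
  cases a <;> cases b <;> simp [bitSign]

theorem bitSign_injective : Function.Injective bitSign := by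
  intro a b
  cases a <;> cases b <;> simp [bitSign]

theorem bitSign_flipFirst_castLE (hn : lam ≤ n) (v : Bits lam) (y : Bits n) (j : Fin lam) :
    bitSign (flipFirst v y (j.castLE hn)) = bitSign (v j) * bitSign (y (j.castLE hn)) := by
  simp [flipFirst, bitSign_xor]

variable {κ : Type} [DecidableEq κ]

theorem parity_update_of_mem (hn : lam ≤ n) {A : Finset κ} {a : κ} (ha : a ∈ A) (v : Bits lam)
    (x : κ → Bits n) : parity hn (Function.update x a (flipFirst v (x a))) A =
      (fun j => bitSign (v j)) * parity hn x A := by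
  funext j
  simp only [parity, Pi.mul_apply]
  rw [← Finset.mul_prod_erase A _ ha, ← Finset.mul_prod_erase A _ ha, Function.update_self,
    bitSign_flipFirst_castLE, mul_assoc]
  refine congrArg _ (congrArg _ (Finset.prod_congr rfl fun c hc => ?_))
  rw [Function.update_of_ne (Finset.ne_of_mem_erase hc)]

theorem parity_update_of_notMem (hn : lam ≤ n) {B : Finset κ} {a : κ} (ha : a ∉ B)
    (x : κ → Bits n) (y : Bits n) : parity hn (Function.update x a y) B = parity hn x B :=
  funext fun _ => Finset.prod_congr rfl fun _ hc => by
    rw [Function.update_of_ne (ne_of_mem_of_not_mem hc ha)]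

variable [Fintype κ]

-- Flipping bits of an entry in `A` but not in `B` moves a collision to `2 ^ lam` distinct tuples.
theorem card_parity_eq_mul_le (hn : lam ≤ n) {A B : Finset κ} (hAB : ¬ A ⊆ B) :
    (Finset.univ.filter fun x : κ → Bits n => parity hn x A = parity hn x B).card * 2 ^ lam ≤
      (2 ^ n) ^ Fintype.card κ := by
  obtain ⟨a, haA, haB⟩ := Finset.not_subset.1 hAB
  let flip (q : {x : κ → Bits n // parity hn x A = parity hn x B} × Bits lam) : κ → Bits n :=
    Function.update q.1.1 a (flipFirst q.2 (q.1.1 a))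
  have sign_eq (q) : (fun j => bitSign (q.2 j)) = parity hn (flip q) A / parity hn (flip q) B := by
    rw [parity_update_of_mem hn haA, parity_update_of_notMem hn haB, q.1.2, mul_div_cancel_right]
  have unflip (q) : Function.update (flip q) a (flipFirst q.2 (flip q a)) = q.1.1 := by
    simp [flip, flipFirst_flipFirst]
  have flip_injective : Function.Injective flip := fun q r hqr => by
    have hsnd : q.2 = r.2 := funext fun j => bitSign_injective <|
      congrFun ((sign_eq q).trans (hqr ▸ (sign_eq r).symm)) j
    refine Prod.ext (Subtype.ext ?_) hsnd
    rw [← unflip q, ← unflip r, hqr, hsnd]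
  simpa [Fintype.card_subtype] using Fintype.card_le_of_injective flip flip_injective

open Classical in
theorem card_not_parity_injOn_mul_le (hn : lam ≤ n) (ℓ : ℕ) :
    (Finset.univ.filter fun x : κ → Bits n =>
        ¬ {A : Finset κ | A.card = ℓ}.InjOn (parity hn x)).card * 2 ^ lam ≤
      Fintype.card κ ^ (2 * ℓ) * (2 ^ n) ^ Fintype.card κ := by
  let pairs : Finset (Finset κ × Finset κ) :=
    (Finset.univ.powersetCard ℓ ×ˢ Finset.univ.powersetCard ℓ).filter fun q => q.1 ≠ q.2
  let collisions (q : Finset κ × Finset κ) : Finset (κ → Bits n) :=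
    Finset.univ.filter fun x => parity hn x q.1 = parity hn x q.2
  have cover : (Finset.univ.filter fun x : κ → Bits n =>
      ¬ {A : Finset κ | A.card = ℓ}.InjOn (parity hn x)) ⊆ pairs.biUnion collisions := by
    intro x hx
    have hnot := (Finset.mem_filter.1 hx).2
    simp only [Set.InjOn, Set.mem_ofPred_eq] at hnot
    push Not at hnot
    obtain ⟨A, hA, B, hB, hparity, hAB⟩ := hnot
    refine Finset.mem_biUnion.2 ⟨(A, B), ?_, Finset.mem_filter.2 ⟨Finset.mem_univ _, hparity⟩⟩
    simp [pairs, Finset.mem_powersetCard, hA, hB, hAB]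
  have card_pairs : pairs.card ≤ Fintype.card κ ^ (2 * ℓ) := by
    refine (Finset.card_filter_le _ _).trans ?_
    rw [Finset.card_product, Finset.card_powersetCard, Finset.card_univ, two_mul, pow_add]
    exact Nat.mul_le_mul (Nat.choose_le_pow _ ℓ) (Nat.choose_le_pow _ ℓ)
  have card_collisions (q) (hq : q ∈ pairs) :
      (collisions q).card * 2 ^ lam ≤ (2 ^ n) ^ Fintype.card κ := by
    simp only [pairs, Finset.mem_filter, Finset.mem_product, Finset.mem_powersetCard_univ] at hq
    exact card_parity_eq_mul_le hn fun h =>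
      hq.2 (Finset.eq_of_subset_of_card_le h (hq.1.2.trans hq.1.1.symm).le)
  calc _ ≤ (∑ q ∈ pairs, (collisions q).card) * 2 ^ lam :=
        Nat.mul_le_mul_right _ ((Finset.card_le_card cover).trans Finset.card_biUnion_le)
    _ = ∑ q ∈ pairs, (collisions q).card * 2 ^ lam := Finset.sum_mul _ _ _
    _ ≤ pairs.card * (2 ^ n) ^ Fintype.card κ := Finset.sum_le_card_nsmul _ _ _ card_collisions
    _ ≤ _ := Nat.mul_le_mul_right _ card_pairs

end ParityCollision

section CollisionWeight

open MeasureTheory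

variable {lam n : ℕ} {κ : Type} [Fintype κ] [DecidableEq κ] (μ : Measure (UnitSphere (Bits n)))
  [IsProbabilityMeasure μ] [IsUnitarilyInvariant μ]

open Classical in
theorem sum_momentOp_injective_parity_collision_le (hn : lam ≤ n) (ℓ : ℕ) :
    ∑ x : κ → Bits n with Function.Injective x ∧
        ¬ {A : Finset κ | A.card = ℓ}.InjOn (parity hn x), (momentOp μ κ x x).re ≤
      (Fintype.card κ : ℝ) ^ (2 * ℓ) / 2 ^ lam := by
  have count : ((Finset.univ.filter fun x : κ → Bits n => Function.Injective x ∧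
      ¬ {A : Finset κ | A.card = ℓ}.InjOn (parity hn x)).card : ℝ) * 2 ^ lam ≤
        (Fintype.card κ : ℝ) ^ (2 * ℓ) * (2 ^ n) ^ Fintype.card κ := by
    refine mod_cast le_trans (Nat.mul_le_mul_right _ (Finset.card_le_card ?_))
      (card_not_parity_injOn_mul_le hn ℓ)
    exact Finset.monotone_filter_right _ fun x _ hx => hx.2
  refine (Finset.sum_le_card_nsmul _ _ _ fun x hx =>
    momentOp_apply_self_re_le_of_injective μ (Finset.mem_filter.1 hx).2.1).trans ?_
  rw [nsmul_eq_mul, ← div_eq_mul_inv, div_le_div_iff₀ (by positivity) (by positivity)]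
  simpa using count

open Classical in
theorem sum_momentOp_not_collisionFree_le (hn : lam ≤ n) {ℓ : ℕ} (hℓ : 0 < ℓ) :
    ∑ x : κ → Bits n with ¬ CollisionFree hn ℓ x, (momentOp μ κ x x).re ≤
      2 * ((Fintype.card κ : ℝ) ^ (2 * ℓ) / 2 ^ lam) := by
  have split : (Finset.univ.filter fun x : κ → Bits n => ¬ CollisionFree hn ℓ x) =
      (Finset.univ.filter fun x => ¬ Function.Injective x) ∪ Finset.univ.filter fun x =>
        Function.Injective x ∧ ¬ {A : Finset κ | A.card = ℓ}.InjOn (parity hn x) := by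
    rw [← Finset.filter_or]
    refine Finset.filter_congr fun x _ => ?_
    have : CollisionFree hn ℓ x ↔ Function.Injective x ∧
        {A : Finset κ | A.card = ℓ}.InjOn (parity hn x) :=
      ⟨fun h => ⟨h.injective, h.parity_injOn⟩, fun h => ⟨h.1, h.2⟩⟩
    tauto
  have injective_bound : (Fintype.card κ : ℝ) ^ 2 / Fintype.card (Bits n) ≤
      (Fintype.card κ : ℝ) ^ (2 * ℓ) / 2 ^ lam := by
    have hpow : Fintype.card κ ^ 2 ≤ Fintype.card κ ^ (2 * ℓ) :=
      (Nat.le_self_pow hℓ.ne' _).trans_eq (pow_mul _ _ _).symm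
    have hcard : (2 : ℝ) ^ lam ≤ Fintype.card (Bits n) := by
      simpa using pow_le_pow_right₀ one_le_two hn
    exact div_le_div₀ (by positivity) (mod_cast hpow) (by positivity) hcard
  rw [split, Finset.sum_union (Finset.disjoint_filter.2 fun _ _ h h' => h h'.1), two_mul]
  exact add_le_add ((sum_momentOp_not_injective_le μ).trans injective_bound)
    (sum_momentOp_injective_parity_collision_le μ hn ℓ)

end CollisionWeight

/-! ### Negligible bounds -/

section Asymptotic

open Filter Asymptotics

theorem PolyBounded.exists_isBigO_pow {f : ℕ → ℕ} (hf : PolyBounded f) :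
    ∃ a : ℕ, (fun m => (f m : ℝ)) =O[atTop] fun m : ℕ => (m : ℝ) ^ a := by
  obtain ⟨q, hq⟩ := hf
  refine ⟨q.natDegree, IsBigO.trans (IsBigO.of_norm_le fun m => ?_)
    ((Polynomial.isBigO_atTop_of_degree_le (q.map (Nat.castRingHom ℝ))
      (Polynomial.X ^ q.natDegree) ?_).comp_tendsto tendsto_natCast_atTop_atTop |>.congr_right
        fun m => by simp)⟩
  · rw [Real.norm_natCast, Function.comp_apply, Polynomial.eval_natCast_map]
    exact Nat.cast_le.2 (hq m)
  · rw [Polynomial.degree_X_pow]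
    exact Polynomial.degree_map_le.trans Polynomial.degree_le_natDegree

theorem isLittleO_mul_log_of_isBigO {u : ℕ → ℝ} {ε : ℝ} (hε : 0 < ε)
    (hu : u =O[atTop] fun m : ℕ => (m : ℝ) / Real.log m ^ (1 + ε)) :
    (fun m => u m * Real.log m) =o[atTop] fun m : ℕ => (m : ℝ) := by
  have hlog : Tendsto (fun m : ℕ => Real.log m) atTop atTop :=
    Real.tendsto_log_atTop.comp tendsto_natCast_atTop_atTop
  have hrpow : (fun m : ℕ => Real.log m ^ (-ε)) =o[atTop] fun _ => (1 : ℝ) :=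
    (isLittleO_one_iff ℝ).2 ((tendsto_rpow_neg_atTop hε).comp hlog)
  have hmul := (isBigO_refl (fun m : ℕ => (m : ℝ)) atTop).mul_isLittleO hrpow
  refine (hu.mul (isBigO_refl (fun m : ℕ => Real.log m) atTop)).trans_isLittleO
    (hmul.congr' ?_ (by simp))
  filter_upwards [hlog.eventually_gt_atTop 0] with m hm
  rw [Real.rpow_add hm, Real.rpow_one, Real.rpow_neg hm.le]
  field_simp

theorem isBigO_of_isLittleO_mul_log {u : ℕ → ℝ}
    (hu : (fun m => u m * Real.log m) =o[atTop] fun m : ℕ => (m : ℝ)) :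
    u =O[atTop] fun m : ℕ => (m : ℝ) := by
  refine IsBigO.trans (IsBigO.of_bound 1 ?_) hu.isBigO
  have hlog : Tendsto (fun m : ℕ => Real.log m) atTop atTop :=
    Real.tendsto_log_atTop.comp tendsto_natCast_atTop_atTop
  filter_upwards [hlog.eventually_ge_atTop 1] with m hm
  rw [one_mul, norm_mul]
  exact le_mul_of_one_le_right (norm_nonneg _) (hm.trans (le_abs_self _))

theorem eventually_pow_le_exp {f ℓ : ℕ → ℕ} {a : ℕ}
    (hf : (fun m => (f m : ℝ)) =O[atTop] fun m : ℕ => (m : ℝ) ^ a)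
    (hℓ : (fun m => (ℓ m : ℝ) * Real.log m) =o[atTop] fun m : ℕ => (m : ℝ))
    {δ : ℝ} (hδ : 0 < δ) : ∀ᶠ m in atTop, (f m : ℝ) ^ (2 * ℓ m) ≤ Real.exp (δ * m) := by
  have hpow : (fun m => (f m : ℝ)) =o[atTop] fun m : ℕ => (m : ℝ) ^ (a + 1) :=
    hf.trans_isLittleO <| (isLittleO_pow_pow_atTop_of_lt a.lt_succ_self).comp_tendsto
      tendsto_natCast_atTop_atTop
  filter_upwards [hpow.eventuallyLE, hℓ.def (c := δ / (2 * (a + 1 : ℕ))) (by positivity),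
    eventually_gt_atTop 0] with m hfm hℓm hm
  have hm' : (0 : ℝ) < m := Nat.cast_pos.2 hm
  rw [Real.norm_natCast, norm_pow, Real.norm_natCast] at hfm
  rw [Real.norm_natCast, div_mul_eq_mul_div, le_div_iff₀' (by positivity)] at hℓm
  calc (f m : ℝ) ^ (2 * ℓ m) ≤ ((m : ℝ) ^ (a + 1)) ^ (2 * ℓ m) := by gcongr
    _ = Real.exp (2 * (a + 1 : ℕ) * (ℓ m * Real.log m)) := by
        rw [← Real.exp_log hm', ← Real.exp_nat_mul, ← Real.exp_nat_mul, Real.log_exp]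
        push_cast
        ring_nf
    _ ≤ Real.exp (δ * m) :=
        Real.exp_le_exp.2 ((mul_le_mul_of_nonneg_left (le_abs_self _) (by positivity)).trans hℓm)

theorem negligible_exp_neg_mul {c : ℝ} (hc : 0 < c) :
    Negligible fun m => Real.exp (-c * m) := fun z => by
  have hexp : |Real.exp (-c)| < 1 := by
    rwa [abs_of_pos (Real.exp_pos _), Real.exp_lt_one_iff, neg_lt_zero]
  simpa only [← Real.exp_nat_mul, mul_comm] using
    tendsto_pow_const_mul_const_pow_of_abs_lt_one z hexp

theorem negligible_pow_div_two_pow {f ℓ : ℕ → ℕ} {a : ℕ}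
    (hf : (fun m => (f m : ℝ)) =O[atTop] fun m : ℕ => (m : ℝ) ^ a)
    (hℓ : (fun m => (ℓ m : ℝ) * Real.log m) =o[atTop] fun m : ℕ => (m : ℝ)) :
    Negligible fun m => (f m : ℝ) ^ (2 * ℓ m) / 2 ^ m := by
  have hlog2 : 0 < Real.log 2 / 2 := half_pos (Real.log_pos one_lt_two)
  refine (negligible_exp_neg_mul hlog2).trans_eventually_abs_le ?_
  filter_upwards [eventually_pow_le_exp hf hℓ hlog2] with m hm
  have two_pow : (2 : ℝ) ^ m = Real.exp (m * Real.log 2) := by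
    rw [Real.exp_nat_mul, Real.exp_log two_pos]
  rw [Function.comp_apply, Function.comp_apply, abs_of_nonneg (by positivity), Real.abs_exp,
    two_pow, div_le_iff₀ (Real.exp_pos _), ← Real.exp_add]
  exact hm.trans_eq (congrArg Real.exp (by ring))

end Asymptotic

section Bounds

variable {lam n ℓ t p : ℕ}

theorem realStateMulti_eq_idealStateMulti (hn : lam ≤ n) (h : ℓ = 0 ∨ p = 0) :
    realStateMulti (phaseMap (lam := lam) n) ℓ t p = idealStateMulti n ℓ t p := by
  ext x y
  have fst_eq : x.1 = y.1 := by
    rcases h with rfl | rfl <;> exact Subsingleton.elim _ _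
  have parity_eq : blockParity hn x = blockParity hn y := by
    unfold blockParity
    rw [fst_eq]
  rw [realStateMulti_apply hn, idealStateMulti_apply, if_pos parity_eq]
  rcases h with rfl | rfl <;> simp [momentOp, Fintype.prod_sum_type]

theorem traceDist_realStateMulti_le (hn : lam ≤ n) (ℓ t p : ℕ) :
    traceDist (realStateMulti (phaseMap (lam := lam) n) ℓ t p) (idealStateMulti n ℓ t p) ≤
      2 * (((min p 1 : ℕ) : ℝ) * (((p : ℝ) * ℓ + t) ^ (2 * ℓ) / 2 ^ lam)) := by
  rcases Nat.eq_zero_or_pos (ℓ * p) with h | h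
  · rw [realStateMulti_eq_idealStateMulti hn (mul_eq_zero.1 h)]
    rw [traceDist_self]
    positivity
  have min_eq : min p 1 = 1 := min_eq_right (Nat.pos_of_mul_pos_left h)
  rw [min_eq, Nat.cast_one, one_mul]
  refine (traceDist_realStateMulti_le_sum hn ℓ t p).trans
    ((sum_momentOp_not_collisionFree_le _ hn (Nat.pos_of_mul_pos_right h)).trans_eq ?_)
  simp

theorem traceDist_realState_le (hn : lam ≤ n) (ℓ t : ℕ) :
    traceDist (realState (phaseMap (lam := lam) n) ℓ t) (idealState n ℓ t) ≤
      2 * (((ℓ : ℝ) + t) ^ (2 * ℓ) / 2 ^ lam) := by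
  rw [realState_eq_submatrix, idealState_eq_submatrix, traceDist_submatrix_equiv]
  simpa using traceDist_realStateMulti_le hn ℓ t 1

end Bounds

section Security

open Asymptotics Filter

theorem negligible_mul_add_pow_div_two_pow {t p ℓ : ℕ → ℕ} (ht : PolyBounded t)
    (hp : PolyBounded p)
    (hℓ : (fun m => (ℓ m : ℝ) * Real.log m) =o[atTop] fun m : ℕ => (m : ℝ)) :
    Negligible fun m => ((p m : ℝ) * ℓ m + t m) ^ (2 * ℓ m) / 2 ^ m := by
  obtain ⟨a, ha⟩ := ht.exists_isBigO_pow
  obtain ⟨b, hb⟩ := hp.exists_isBigO_pow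
  have pow_isBigO {i j : ℕ} (hij : i ≤ j) :
      (fun m : ℕ => (m : ℝ) ^ i) =O[atTop] fun m : ℕ => (m : ℝ) ^ j :=
    IsBigO.pow_of_le_right ((eventually_ge_atTop 1).mono fun m hm => Nat.one_le_cast.2 hm) hij
  have hpℓ : (fun m => (p m : ℝ) * ℓ m) =O[atTop] fun m : ℕ => (m : ℝ) ^ (b + 1) := by
    simpa only [pow_succ] using hb.mul (isBigO_of_isLittleO_mul_log hℓ)
  have hsum := (hpℓ.trans (pow_isBigO (le_max_left (b + 1) a))).add
    (ha.trans (pow_isBigO (le_max_right (b + 1) a)))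
  simpa only [Nat.cast_add, Nat.cast_mul] using
    negligible_pow_div_two_pow (f := fun m => p m * ℓ m + t m) (mod_cast hsum) hℓ

theorem isMultiKeyPRSG_phaseMap {n ℓ : ℕ → ℕ} (hn : ∀ lam, lam ≤ n lam)
    (hℓ : (fun lam => (ℓ lam : ℝ) * Real.log lam) =o[atTop] fun lam : ℕ => (lam : ℝ)) :
    IsMultiKeyPRSG n ℓ fun lam k => phaseMap (lam := lam) (n lam) k where
  qpt := isQPT_phaseMap hn
  channel lam := isChannel_phaseMap (n lam)
  stateGeneration lam := exists_phaseMap_density_eq (n lam)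
  pseudorandomness t p ht hp A := by
    refine ⟨_, (negligible_mul_add_pow_div_two_pow ht hp hℓ).const_mul 2, fun lam => ?_⟩
    calc _ ≤ traceDist (realStateMulti (phaseMap (n lam)) (ℓ lam) (t lam) (p lam))
          (idealStateMulti (n lam) (ℓ lam) (t lam) (p lam)) :=
        (A lam).abs_prob_sub_prob_le_traceDist (posSemidef_realStateMulti (hn lam)).1
          posSemidef_idealStateMulti.1
          ((trace_realStateMulti (hn lam)).trans trace_idealStateMulti.symm)
      _ ≤ _ := traceDist_realStateMulti_le (hn lam) _ _ _
      _ ≤ _ := by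
        gcongr
        exact mul_le_of_le_one_left (by positivity) (mod_cast min_le_right _ _)

end Security

end CHS

end

theorem mainTheorem3_general :
    (∀ n ℓ : ℕ → ℕ, (∀ lam, lam ≤ n lam) →
      Asymptotics.IsLittleO Filter.atTop (fun lam : ℕ => (ℓ lam : ℝ) * Real.log (lam : ℝ))
        (fun lam : ℕ => (lam : ℝ)) →
      CHS.IsMultiKeyPRSG n ℓ (fun lam k => CHS.phaseMap (lam := lam) (n lam) k)) ∧
    (∀ lam n ℓ t : ℕ, lam ≤ n →
      CHS.traceDist (CHS.realState (CHS.phaseMap (lam := lam) n) ℓ t)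
          (CHS.idealState n ℓ t) ≤
        2 * (((ℓ : ℝ) + t) ^ (2 * ℓ) / 2 ^ lam)) ∧
    (∀ lam n ℓ t p : ℕ, lam ≤ n →
      CHS.traceDist (CHS.realStateMulti (CHS.phaseMap (lam := lam) n) ℓ t p)
          (CHS.idealStateMulti n ℓ t p) ≤
        2 * (((min p 1 : ℕ) : ℝ) * (((p : ℝ) * ℓ + t) ^ (2 * ℓ) / 2 ^ lam))) :=
  ⟨fun _ _ hn hℓ => CHS.isMultiKeyPRSG_phaseMap hn hℓ,
    fun _ _ ℓ t hn => CHS.traceDist_realState_le hn ℓ t,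
    fun _ _ ℓ t p hn => CHS.traceDist_realStateMulti_le hn ℓ t p⟩

theorem mainTheorem3 :
    (∀ n : ℕ → ℕ, (∀ lam, lam ≤ n lam) →
      ∀ ε : ℝ, 0 < ε →
      ∀ ℓ : ℕ → ℕ,
        Asymptotics.IsBigO Filter.atTop (fun lam : ℕ => (ℓ lam : ℝ))
          (fun lam : ℕ => (lam : ℝ) / Real.log (lam : ℝ) ^ (1 + ε)) →
        CHS.IsMultiKeyPRSG n ℓ (fun lam k => CHS.phaseMap (lam := lam) (n lam) k)) ∧
    (∃ c : ℝ, ∀ lam n ℓ t : ℕ, lam ≤ n →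
      CHS.traceDist (CHS.realState (CHS.phaseMap (lam := lam) n) ℓ t)
          (CHS.idealState n ℓ t) ≤
        c * (((ℓ : ℝ) + t) ^ (2 * ℓ) / 2 ^ lam)) ∧
    (∃ c : ℝ, ∀ lam n ℓ t p : ℕ, lam ≤ n →
      CHS.traceDist (CHS.realStateMulti (CHS.phaseMap (lam := lam) n) ℓ t p)
          (CHS.idealStateMulti n ℓ t p) ≤
        c * ((p : ℝ) * ((p : ℝ) * ℓ + t) ^ (2 * ℓ) / 2 ^ lam)) := by
  obtain ⟨prsg, single, multi⟩ := mainTheorem3_general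
  refine ⟨fun n hn ε hε ℓ hℓ => prsg n ℓ hn (CHS.isLittleO_mul_log_of_isBigO hε hℓ), ⟨2, single⟩,
    ⟨2, fun lam n ℓ t p hn => (multi lam n ℓ t p hn).trans ?_⟩⟩
  rw [mul_div_assoc]
  gcongr
  exact min_le_left p 1
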